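/- Let $\alpha\in(0,2)$, $\sigma_w,\sigma_b>0$, and let $I,k,D\ge 1$. Let $\phi:\mathbb R\to\mathbb R$ be continuous, strictly monotone and bounded, and let $\mathbf X$ be an $I\times k$ real matrix with rows $\mathbf x_1,\dots,\mathbf x_I$ such that $\{\mathbf 1,\mathbf x_1,\dots,\mathbf x_I\}$ spans $\mathbb R^k$, where $\mathbf 1=(1,\dots,1)$. $\mathrm{St}(\alpha,\sigma)$ denotes the law on $\mathbb R$ with characteristic function $t\mapsto e^{-\sigma^\alpha|t|^\alpha}$, and, for a finite measure $\Gamma$ on the unit sphere $\mathbb S^{k-1}$ of $\mathbb R^k$, $\mathrm{St}_k(\alpha,\Gamma)$ denotes the law on $\mathbb R^k$ with characteristic function $\mathbf t\mapsto\exp\{-\int_{\mathbb S^{k-1}}|\langle \mathbf s,\mathbf t\rangle|^\alpha\,\Gamma(\mathrm d\mathbf s)\}$. On a probability space let the weights $w^{(1)}_{i,j}$ ($i\ge1$, $1\le j\le I$) and $w^{(l)}_{i,j}$ ($2\le l\le D$, $i,j\ge 1$) be distributed as $\mathrm{St}(\alpha,\sigma_w)$ and the biases $b^{(l)}_i$ ($1\le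 l\le D$, $i\ge1$) as $\mathrm{St}(\alpha,\sigma_b)$, all of them independent. The width grows one layer at a time: for $i\ge 1$ put $$\check f^{(1)}_i(n)=\check f^{(1)}_i=\sum_{j=1}^I w^{(1)}_{i,j}\mathbf x_j+b^{(1)}_i\mathbf 1,\qquad \check f^{(l)}_i(n)=\frac1{n^{1/\alpha}}\sum_{j=1}^n w^{(l)}_{i,j}\,(\phi\circ\check f^{(l-1)}_j)+b^{(l)}_i\mathbf 1\quad(2\le l\le D),$$ where $\phi$ acts entrywise and, for $2\le l\le D$, $(\check f^{(l)}_i)_{i\ge1}$ is a sequence of random vectors of $\mathbb R^k$ such that $(\check f^{(l)}_i(n))_{i\ge1}$ converges weakly to $(\check f^{(l)}_i)_{i\ge1}$ as $n\to\infty$. Let $\mathcal G_l$ be the sigma-algebra generated by $\{\check f^{(l')}_i: 1\le l'\le l,\ i\ge1\}$ ($\mathcal G_0$ is trivial); the weights and biases of each layer $l\ge2$ are independent of $\mathcal G_{l-1}$. Then for every $l=1,\dots,D$: (a) $(\check f^{(l)}_i)_{i\ge1}$ is i.i.d. with law $\mathrm{St}_k(\alpha,\Gamma^{(l)})$, where,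 with $\zeta_h=\frac12(\delta_{h/\|h\|}+\delta_{-h/\|h\|})$ for $h\ne0$, $\zeta_0=0$, and $q^{(l-1)}$ the law of $\check f^{(l-1)}_i$, $$\Gamma^{(1)}=\|\sigma_b\mathbf 1\|^\alpha\zeta_{\mathbf 1}+\sigma_w^\alpha\sum_{j=1}^I\|\mathbf x_j\|^\alpha\zeta_{\mathbf x_j},\qquad \Gamma^{(l)}=\|\sigma_b\mathbf 1\|^\alpha\zeta_{\mathbf 1}+\int\|\sigma_w(\phi\circ f)\|^\alpha\zeta_{\phi\circ f}\,q^{(l-1)}(\mathrm df)\quad(l\ge2).$$ (b) The law of $\check f^{(l)}_i$ is absolutely continuous with respect to Lebesgue measure; and almost surely the conditional law of $\check f^{(l)}_i(n)$ given $\mathcal G_{l-1}$ is absolutely continuous for all sufficiently large $n$. (c) Let $\check g^{(l)}$ be a version of the density of $\check f^{(l)}_i$, and $\check g^{(l)}(n)$ a version of the (random) density of the conditional law of $\check f^{(l)}_i(n)$ given $\mathcal G_{l-1}$, defined arbitrarily where that density does not exist. Then for every $\epsilon>0$, as $n\to\infty$, $$n^{1/2-\epsilon}\,\|\check g^{(l)}(n)-\check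 g^{(l)}\|_\infty\to 0\quad\text{in probability},$$ where $\|\cdot\|_\infty$ is the essential supremum norm with respect to Lebesgue measure. In particular, the exponent depends neither on the layer $l$ nor on $k$. -/

import Mathlib

open MeasureTheory ProbabilityTheory Filter Topology
open scoped ENNReal

noncomputable section

namespace StableNN

/-- The space `ℝ^k` with its Euclidean norm. -/
abbrev E (k : ℕ) : Type := EuclideanSpace ℝ (Fin k)

/-! ### Stable distributions -/

/-- `μ` is the symmetric centered Stable law `St(α, σ)` on the real line. -/
def IsStable (α σ : ℝ) (μ : Measure ℝ) : Prop :=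
  IsProbabilityMeasure μ ∧
    ∀ t : ℝ, charFun μ t = ((Real.exp (-(σ ^ α * |t| ^ α)) : ℝ) : ℂ)

/-- `μ` is the symmetric centered Stable law `St_k(α, Γ)` on `ℝ^k`, with spectral measure `Γ`:
a finite measure carried by the unit sphere. -/
def IsStableVec {k : ℕ} (α : ℝ) (Γ : Measure (E k)) (μ : Measure (E k)) : Prop :=
  IsProbabilityMeasure μ ∧ IsFiniteMeasure Γ ∧ Γ (Metric.sphere 0 1)ᶜ = 0 ∧
    ∀ t : E k, charFun μ t =
      ((Real.exp (-∫ s in Metric.sphere (0 : E k) 1, |inner ℝ s t| ^ α ∂Γ) : ℝ) : ℂ)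

/-- The measure `ζ_{h/‖h‖} = (δ_{h/‖h‖} + δ_{-h/‖h‖}) / 2` if `h ≠ 0`, and `0` if `h = 0`. -/
def zeta {k : ℕ} (h : E k) : Measure (E k) :=
  open Classical in
  if h = 0 then 0
  else (2⁻¹ : ℝ≥0∞) • (Measure.dirac (‖h‖⁻¹ • h) + Measure.dirac (-(‖h‖⁻¹ • h)))

/-! ### The network -/

/-- The vector of `ℝ^k` all of whose entries are `1`. -/
def ones (k : ℕ) : E k := WithLp.toLp 2 (fun _ => 1)

/-- The `j`-th row of the input matrix, as a vector of `ℝ^k`. -/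
def row {I k : ℕ} (X : Matrix (Fin I) (Fin k) ℝ) (j : Fin I) : E k := WithLp.toLp 2 (X j)

/-- Entrywise application `φ ∘ f`. -/
def act {k : ℕ} (φ : ℝ → ℝ) (f : E k) : E k := WithLp.toLp 2 (fun r => φ (f r))

/-- Names of the parameters of a network of depth `D` with infinitely many nodes per layer and
inputs of dimension `I`: the weights of the first layer, the weights of the layers `2, …, D`, and
the biases of the layers `1, …, D`. -/
inductive Param (D I : ℕ) : Type
  | inputWeight (i : ℕ) (j : Fin I) : Param D I
  | weight (l : Set.Icc 2 D) (i j : ℕ) : Param D I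
  | bias (l : Set.Icc 1 D) (i : ℕ) : Param D I

variable {Ω : Type*}

/-- All the parameters of the network as one family of random variables. -/
def params (D : ℕ) {I : ℕ} (w₁ : ℕ → Fin I → Ω → ℝ) (w : ℕ → ℕ → ℕ → Ω → ℝ)
    (b : ℕ → ℕ → Ω → ℝ) : Param D I → Ω → ℝ
  | .inputWeight i j => w₁ i j
  | .weight l i j => w l i j
  | .bias l i => b l i

/-- The `i`-th node of the first layer: `∑_j w^{(1)}_{i,j} x_j + b^{(1)}_i 1`. -/
def firstLayer {I k : ℕ} (X : Matrix (Fin I) (Fin k) ℝ) (w₁ : ℕ → Fin I → Ω → ℝ)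
    (b : ℕ → ℕ → Ω → ℝ) (i : ℕ) (ω : Ω) : E k :=
  (∑ j, w₁ i j ω • row X j) + b 1 i ω • ones k

/-- The `i`-th node of layer `l` of the sequentially grown network at width `n`: for `l ≥ 2` the
`n` inputs of the node are the activations of the first `n` terms of the sequence `F (l - 1)`.
The first layer does not depend on `n`. (Nodes are numbered from `0`; layers from `1`.) -/
def layer {I k : ℕ} (α : ℝ) (φ : ℝ → ℝ) (X : Matrix (Fin I) (Fin k) ℝ)
    (w₁ : ℕ → Fin I → Ω → ℝ) (w : ℕ → ℕ → ℕ → Ω → ℝ) (b : ℕ → ℕ → Ω → ℝ)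
    (F : ℕ → ℕ → Ω → E k) : (l n i : ℕ) → Ω → E k
  | 0, _, _, _ => 0
  | 1, _, i, ω => firstLayer X w₁ b i ω
  | l + 2, n, i, ω =>
      ((n : ℝ) ^ (1 / α))⁻¹ • (∑ j ∈ Finset.range n, w (l + 2) i j ω • act φ (F (l + 1) j ω))
        + b (l + 2) i ω • ones k

/-- The sigma-algebra generated by the weights and biases of layer `l ≥ 2`. -/
abbrev layerSigma (w : ℕ → ℕ → ℕ → Ω → ℝ) (b : ℕ → ℕ → Ω → ℝ) (l : ℕ) : MeasurableSpace Ω :=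
  (⨆ i, ⨆ j, MeasurableSpace.comap (w l i j) inferInstance) ⊔
    ⨆ i, MeasurableSpace.comap (b l i) inferInstance

/-- The sigma-algebra `𝒢_l` generated by the vectors `F l' i`, `1 ≤ l' ≤ l`, `i ≥ 0`;
`𝒢_0` is trivial. -/
abbrev past {k : ℕ} (F : ℕ → ℕ → Ω → E k) (l : ℕ) : MeasurableSpace Ω :=
  ⨆ l' ∈ Set.Icc 1 l, ⨆ i, MeasurableSpace.comap (F l' i) inferInstance

/-- A Stable network of depth `D` grown one layer at a time, on the probability space `(Ω, P)`.
The weights (i.i.d. `St(α, σw)`) and the biases (i.i.d. `St(α, σb)`) are all independent. The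
sequence `F l` of random vectors is the already infinitely wide layer `l`: it is the first layer
itself for `l = 1`, and for `l ≥ 2` a sequence to which layer `l`, built at width `n` on top of
`F (l - 1)`, converges weakly as `n → ∞`. The weights and biases of layer `l` are independent of
the limits `F 1, …, F (l - 1)` of the previous layers. -/
structure IsSequentialNN [MeasurableSpace Ω] (P : Measure Ω) [IsProbabilityMeasure P]
    (α σw σb : ℝ) (φ : ℝ → ℝ) {I k : ℕ} (X : Matrix (Fin I) (Fin k) ℝ) (D : ℕ)
    (w₁ : ℕ → Fin I → Ω → ℝ) (w : ℕ → ℕ → ℕ → Ω → ℝ) (b : ℕ → ℕ → Ω → ℝ)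
    (F : ℕ → ℕ → Ω → E k) : Prop where
  measurable_params : ∀ p, Measurable (params D w₁ w b p)
  law_inputWeight : ∀ i j, IsStable α σw (P.map (w₁ i j))
  law_weight : ∀ l ∈ Set.Icc 2 D, ∀ i j, IsStable α σw (P.map (w l i j))
  law_bias : ∀ l ∈ Set.Icc 1 D, ∀ i, IsStable α σb (P.map (b l i))
  indep_params : iIndepFun (params D w₁ w b) P
  measurable_limit : ∀ l ∈ Set.Icc 1 D, ∀ i, Measurable (F l i)
  limit_one : F 1 = firstLayer X w₁ b
  limit_layer : ∀ l ∈ Set.Icc 2 D,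
    TendstoInDistribution (fun (n : ℕ) ω i => layer α φ X w₁ w b F l n i ω) atTop
      (fun ω i => F l i ω) (fun _ => P) P
  indep_past : ∀ l ∈ Set.Icc 2 D, Indep (layerSigma w b l) (past F (l - 1)) P

/-- The spectral measures `Γ^{(l)}`: those of the first layer for `l = 1`, and for `l ≥ 2` those
determined by the law `q^{(l-1)}` of a term of the sequence `F (l - 1)`. -/
def spectral [MeasurableSpace Ω] (P : Measure Ω) (α σw σb : ℝ) (φ : ℝ → ℝ) {I k : ℕ}
    (X : Matrix (Fin I) (Fin k) ℝ) (F : ℕ → ℕ → Ω → E k) : ℕ → Measure (E k)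
  | 0 => 0
  | 1 => ENNReal.ofReal (‖σb • ones k‖ ^ α) • zeta (ones k)
      + ∑ j, ENNReal.ofReal (σw ^ α * ‖row X j‖ ^ α) • zeta (row X j)
  | l + 2 => ENNReal.ofReal (‖σb • ones k‖ ^ α) • zeta (ones k)
      + (P.map (F (l + 1) 0)).bind
          (fun f => ENNReal.ofReal (‖σw • act φ f‖ ^ α) • zeta (act φ f))

/-! ### Conditional laws and densities -/

/-- The (regular) conditional law of `Y` given the sigma-algebra `m`. -/
def condLaw {k : ℕ} [mΩ : MeasurableSpace Ω] (P : Measure Ω) [IsProbabilityMeasure P]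
    (m : MeasurableSpace Ω) (Y : Ω → E k) (ω : Ω) : Measure (E k) :=
  @condDistrib Ω Ω (E k) _ _ _ mΩ m Y id P _ ω

/-- `g` is a version of the density of `μ` with respect to Lebesgue measure. -/
def IsDensity {k : ℕ} (μ : Measure (E k)) (g : E k → ℝ) : Prop :=
  Measurable g ∧ (∀ x, 0 ≤ g x) ∧ μ = volume.withDensity (fun x => ENNReal.ofReal (g x))

end StableNN

end

/-!
Everything is read off characteristic functions. A node of width `n` whose inputs `a_0, …, a_{n-1}`
(the activations of the previous infinitely wide layer) are frozen is a linear combination of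
independent Stable variables, so its characteristic function is `exp (-A_n)` with
`A_n(t) = σ_w^α (1/n) ∑_j |⟨a_j, t⟩|^α + σ_b^α |⟨1, t⟩|^α`. As the weights and biases of a layer are
independent of the past, freezing the inputs is the same as conditioning on the past
(`condDistrib_of_indepFun_freeze`), and the nodes of a layer are conditionally independent.

The inputs being i.i.d. (induction on the layer), the strong law of large numbers gives
`A_n(t) → A(t)`, where `A` has the expectation in place of the mean. By dominated convergence the
joint characteristic functions of the nodes converge to products of `exp (-A)`, so the limiting
layer is i.i.d. (`iIndepFun_limit`); integrating `|⟨s, t⟩|^α` against the spectral measure gives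
back `A(t)` (`lintegral_spectral`).

For the densities, the point is a bound `A_n(t), A(t) ≥ c ‖t‖^α` with one deterministic `c > 0`
(`exists_le_exponents`). The activations being bounded by some `R` and `α` less than `2`,
`|⟨a, t⟩|^α ≥ (R ‖t‖)^(α-2) ⟨a, t⟩²`, which reduces the bound to second moments: the empirical second
moment matrix converges, and its limit is positive definite because the previous layer has a density
and `φ` is injective, so that the activations do not lie on a hyperplane. For the first layer the
bound is the spanning condition on the inputs. The characteristic functions are therefore
integrable, and Fourier inversion (`eq_withDensity_fourierDensity`) yields densities whose uniform
distance is at most `∫ |exp (-A_n) - exp (-A)| ≤ ∫ exp (-c ‖t‖^α) |A_n(t) - A(t)| dt`. The variance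
of a mean of `n` independent bounded variables shows that the expectation of the last integral is
`O(n^{-1/2})`, and Markov's inequality concludes.
-/

noncomputable section

namespace StableNN

/-! ### Fourier inversion for finite measures -/

section FourierInversion

open FourierTransform
open scoped ContDiff Manifold

/-- Smooth Urysohn lemma with compact support. -/
lemma exists_contDiff_between {V : Type*} [NormedAddCommGroup V] [InnerProductSpace ℝ V]
    [FiniteDimensional ℝ V] {K U : Set V} (hK : IsCompact K) (hU : IsOpen U) (hKU : K ⊆ U) :
    ∃ u : V → ℝ, ContDiff ℝ ∞ u ∧ HasCompactSupport u ∧ (∀ x, 0 ≤ u x) ∧ (∀ x, u x ≤ 1) ∧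
      (∀ x ∈ K, u x = 1) ∧ ∀ x, x ∉ U → u x = 0 := by
  obtain ⟨L, hL, hKL, hLU⟩ := exists_compact_between hK hU hKU
  obtain ⟨f, hf0, hf1, hf⟩ := exists_contMDiffMap_zero_one_of_isClosed (n := ⊤) 𝓘(ℝ, V)
    (isOpen_interior (s := L)).isClosed_compl hK.isClosed
    (Set.disjoint_left.2 fun x hx hx' => hx (hKL hx'))
  refine ⟨f, f.contMDiff.contDiff, ?_, fun x => (hf x).1, fun x => (hf x).2, fun x hx => hf1 hx,
    fun x hx => hf0 fun h => hx (hLU (interior_subset h))⟩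
  exact HasCompactSupport.intro hL fun x hx => hf0 fun h => hx (interior_subset h)

variable {V : Type*} [NormedAddCommGroup V] [InnerProductSpace ℝ V] [MeasurableSpace V]
  [BorelSpace V] [FiniteDimensional ℝ V]

/-- The candidate density of a measure `μ`: the real part of the inverse Fourier transform of
`ξ ↦ ∫ exp (-2πi⟨x, ξ⟩) dμ(x)`, in Mathlib's normalization of the Fourier transform. -/
def fourierDensity (μ : Measure V) (x : V) : ℝ :=
  (𝓕⁻ (fun ξ => charFun μ ((-(2 * Real.pi)) • ξ)) x).re

lemma integrable_charFun_smul {μ : Measure V} (h : Integrable (charFun μ)) :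
    Integrable (fun ξ => charFun μ ((-(2 * Real.pi)) • ξ)) :=
  h.comp_smul (neg_ne_zero.2 (by positivity))

lemma continuous_fourierInv {f : V → ℂ} (hf : Integrable f) : Continuous (𝓕⁻ f) := by
  have : Continuous fun p : V × V => (-innerₗ V) p.1 p.2 := continuous_inner.neg
  exact VectorFourier.fourierIntegral_continuous Real.continuous_fourierChar this hf

lemma continuous_fourierDensity {μ : Measure V} (h : Integrable (charFun μ)) :
    Continuous (fourierDensity μ) :=
  Complex.continuous_re.comp (continuous_fourierInv (integrable_charFun_smul h))

/-- Integrating a Schwartz function against `μ` is integrating it against the inverse Fourier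
transform of the characteristic function: write the function as a Fourier transform and apply
Fubini twice. -/
lemma integral_schwartzMap_eq {μ : Measure V} [IsFiniteMeasure μ] (h : Integrable (charFun μ))
    (u : SchwartzMap V ℂ) :
    ∫ x, u x ∂μ = ∫ x, u x * 𝓕⁻ (fun ξ => charFun μ ((-(2 * Real.pi)) • ξ)) x := by
  have hL : Continuous fun p : V × V => (-innerₗ V) p.1 p.2 := continuous_inner.neg
  have h1 := VectorFourier.integral_fourierIntegral_smul_eq_flip (L := innerₗ V) (μ := μ)
    (ν := volume) (f := fun _ => (1 : ℂ)) (g := ⇑(𝓕⁻ u : SchwartzMap V ℂ))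
    Real.continuous_fourierChar continuous_inner (integrable_const _) (𝓕⁻ u : SchwartzMap V ℂ).integrable
  have h2 := VectorFourier.integral_fourierIntegral_smul_eq_flip (L := -innerₗ V)
    (μ := (volume : Measure V)) (ν := volume) (f := ⇑u)
    (g := fun ξ => charFun μ ((-(2 * Real.pi)) • ξ)) Real.continuous_fourierChar
    hL u.integrable (integrable_charFun_smul h)
  have h3 : ∀ x, VectorFourier.fourierIntegral Real.fourierChar volume (innerₗ V).flip
      (⇑(𝓕⁻ u : SchwartzMap V ℂ)) x = u x := by
    intro x
    have : 𝓕 (𝓕⁻ u : SchwartzMap V ℂ) = u := FourierTransform.fourier_fourierInv_eq u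
    rw [flip_innerₗ]
    calc _ = 𝓕 (⇑(𝓕⁻ u : SchwartzMap V ℂ)) x := rfl
      _ = (𝓕 (𝓕⁻ u : SchwartzMap V ℂ) : SchwartzMap V ℂ) x := by rw [SchwartzMap.fourier_coe]
      _ = u x := by rw [this]
  have h4 : ∀ ξ, VectorFourier.fourierIntegral Real.fourierChar μ (innerₗ V) (fun _ => (1 : ℂ)) ξ
      = charFun μ ((-(2 * Real.pi)) • ξ) := by
    intro ξ
    rw [charFun_eq_fourierIntegral', smul_smul]
    rw [neg_mul_neg, inv_mul_cancel₀ (by positivity), one_smul]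
    rfl
  have h5 : ∀ ξ, VectorFourier.fourierIntegral Real.fourierChar volume (-innerₗ V) (⇑u) ξ
      = (𝓕⁻ u : SchwartzMap V ℂ) ξ := by
    intro ξ
    rw [SchwartzMap.fourierInv_coe]; rfl
  have h6 : (-innerₗ V).flip = -innerₗ V := by
    ext x y; simp [real_inner_comm]
  simp only [h3, h4, one_smul] at h1
  simp only [h5, h6] at h2
  rw [← h1]
  simp only [smul_eq_mul] at h2 ⊢
  calc _ = ∫ ξ, (𝓕⁻ u : SchwartzMap V ℂ) ξ * charFun μ ((-(2 * Real.pi)) • ξ) := by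
        congr 1; ext ξ; ring
    _ = _ := h2

lemma integral_contDiff_eq {μ : Measure V} [IsFiniteMeasure μ] (h : Integrable (charFun μ))
    {u : V → ℝ} (hu : ContDiff ℝ ∞ u) (hc : HasCompactSupport u) :
    ∫ x, u x ∂μ = ∫ x, u x * fourierDensity μ x := by
  have hu' : ContDiff ℝ ∞ (fun x => (u x : ℂ)) := Complex.ofRealCLM.contDiff.comp hu
  have hc' : HasCompactSupport (fun x => (u x : ℂ)) := hc.comp_left (g := Complex.ofReal) rfl
  have key := integral_schwartzMap_eq h (hc'.toSchwartzMap hu')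
  have hcont := continuous_fourierInv (integrable_charFun_smul h)
  change ∫ x, (u x : ℂ) ∂μ = ∫ x, (u x : ℂ) * _ at key
  have hint : Integrable (fun x => (u x : ℂ) *
      𝓕⁻ (fun ξ => charFun μ ((-(2 * Real.pi)) • ξ)) x) := by
    refine Continuous.integrable_of_hasCompactSupport (hu'.continuous.mul hcont) ?_
    exact hc'.mul_right
  have := congrArg Complex.re key
  rw [integral_complex_ofReal, Complex.ofReal_re] at this
  rw [this]
  have := integral_re hint
  simp only [RCLike.re_eq_complex_re] at this
  rw [← this]
  simp [fourierDensity]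

lemma fourierDensity_nonneg {μ : Measure V} [IsFiniteMeasure μ] (h : Integrable (charFun μ))
    (x : V) : 0 ≤ fourierDensity μ x := by
  by_contra! hx
  have hG := continuous_fourierDensity h
  have hs : {y | fourierDensity μ y < 0} ∈ 𝓝 x := (isOpen_lt hG continuous_const).mem_nhds hx
  obtain ⟨u, hu1, hu2, hu3, hu4, hu5⟩ := exists_contDiff_tsupport_subset (n := ⊤) hs
  have hu0 : ∀ y, 0 ≤ u y := fun y => (hu4 ⟨y, rfl⟩).1
  have key := integral_contDiff_eq h hu3 hu2
  have h1 : 0 ≤ ∫ y, u y ∂μ := integral_nonneg hu0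
  have h2 : 0 < ∫ y, -(u y * fourierDensity μ y) := by
    refine Continuous.integral_pos_of_hasCompactSupport_nonneg_nonzero (x := x)
      (hu3.continuous.mul hG).neg (hu2.mul_right).neg ?_ ?_
    · intro y
      by_cases hy : y ∈ tsupport u
      · exact neg_nonneg.2 (mul_nonpos_of_nonneg_of_nonpos (hu0 y) (hu1 hy).le)
      · simp [image_eq_zero_of_notMem_tsupport hy]
    · simp [hu5, hx.ne]
  rw [integral_neg] at h2
  linarith

/-- **Fourier inversion for measures**: a finite measure with integrable characteristic function
has the density `fourierDensity`. -/
theorem eq_withDensity_fourierDensity {μ : Measure V} [IsFiniteMeasure μ]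
    (h : Integrable (charFun μ)) :
    μ = volume.withDensity (fun x => ENNReal.ofReal (fourierDensity μ x)) := by
  have hG := continuous_fourierDensity h
  have : IsLocallyFiniteMeasure
      ((volume : Measure V).withDensity (fun x => ENNReal.ofReal (fourierDensity μ x))) :=
    IsLocallyFiniteMeasure.withDensity_ofReal hG
  set ν := (volume : Measure V).withDensity (fun x => ENNReal.ofReal (fourierDensity μ x)) with hν
  have hint : ∀ u : V → ℝ, ContDiff ℝ ∞ u → HasCompactSupport u → (∀ x, 0 ≤ u x) →
      ∫⁻ x, ENNReal.ofReal (u x) ∂μ = ∫⁻ x, ENNReal.ofReal (u x) ∂ν := by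
    intro u hu hc h0
    rw [hν, lintegral_withDensity_eq_lintegral_mul _ (by fun_prop)
      (hu.continuous.measurable.ennreal_ofReal),
      ← ofReal_integral_eq_lintegral_ofReal (hu.continuous.integrable_of_hasCompactSupport hc)
      (ae_of_all _ h0), integral_contDiff_eq h hu hc,
      ofReal_integral_eq_lintegral_ofReal (f := fun x => u x * fourierDensity μ x)
      ((hu.continuous.mul hG).integrable_of_hasCompactSupport hc.mul_right)
      (ae_of_all _ fun x => mul_nonneg (h0 x) (fourierDensity_nonneg h x))]
    refine lintegral_congr fun x => ?_
    rw [Pi.mul_apply, mul_comm, ENNReal.ofReal_mul (fourierDensity_nonneg h x)]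
  have hle : ∀ μ₁ μ₂ : Measure V, (∀ u : V → ℝ, ContDiff ℝ ∞ u → HasCompactSupport u →
      (∀ x, 0 ≤ u x) → ∫⁻ x, ENNReal.ofReal (u x) ∂μ₁ = ∫⁻ x, ENNReal.ofReal (u x) ∂μ₂) →
      ∀ K U : Set V, IsCompact K → IsOpen U → K ⊆ U → μ₁ K ≤ μ₂ U := by
    intro μ₁ μ₂ heq K U hK hU hKU
    obtain ⟨u, hu, hc, h0, h1, hK1, hU0⟩ := exists_contDiff_between hK hU hKU
    calc μ₁ K = ∫⁻ x, K.indicator 1 x ∂μ₁ := (lintegral_indicator_one hK.measurableSet).symm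
      _ ≤ ∫⁻ x, ENNReal.ofReal (u x) ∂μ₁ := by
        refine lintegral_mono fun x => ?_
        by_cases hx : x ∈ K <;> simp [hx, hK1]
      _ = ∫⁻ x, ENNReal.ofReal (u x) ∂μ₂ := heq u hu hc h0
      _ ≤ ∫⁻ x, U.indicator 1 x ∂μ₂ := by
        refine lintegral_mono fun x => ?_
        by_cases hx : x ∈ U <;> simp [hx, hU0, h1]
      _ = μ₂ U := lintegral_indicator_one hU.measurableSet
  refine Measure.OuterRegular.ext_isOpen fun U hU => le_antisymm ?_ ?_
  · rw [hU.measure_eq_iSup_isCompact]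
    exact iSup₂_le fun K hKU => iSup_le fun hK => hle μ ν hint K U hK hU hKU
  · rw [hU.measure_eq_iSup_isCompact]
    exact iSup₂_le fun K hKU => iSup_le fun hK =>
      hle ν μ (fun u hu hc h0 => (hint u hu hc h0).symm) K U hK hU hKU

lemma absolutelyContinuous_of_integrable_charFun {μ : Measure V} [IsFiniteMeasure μ]
    (h : Integrable (charFun μ)) : μ ≪ volume := by
  rw [eq_withDensity_fourierDensity h]
  exact withDensity_absolutelyContinuous _ _

lemma abs_fourierDensity_sub_le {μ ν : Measure V} (hμ : Integrable (charFun μ))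
    (hν : Integrable (charFun ν)) (x : V) :
    |fourierDensity μ x - fourierDensity ν x| ≤ ∫ t, ‖charFun μ t - charFun ν t‖ := by
  have h1 := integrable_charFun_smul hμ
  have h2 := integrable_charFun_smul hν
  have hF : ∀ f : V → ℂ, Integrable f →
      Integrable (fun v => Real.fourierChar (inner ℝ v x) • f v) := by
    intro f hf
    have := (Real.fourierIntegral_convergent_iff (μ := volume) (f := f) (-x)).2 hf
    simpa using this
  rw [fourierDensity, fourierDensity, ← Complex.sub_re]
  refine (Complex.abs_re_le_norm _).trans ?_
  rw [Real.fourierInv_eq, Real.fourierInv_eq, ← integral_sub (hF _ h1) (hF _ h2)]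
  refine (norm_integral_le_integral_norm _).trans ?_
  simp_rw [← smul_sub, Circle.norm_smul]
  rw [Measure.integral_comp_smul volume (fun t => ‖charFun μ t - charFun ν t‖), smul_eq_mul]
  -- The change of variables contributes the factor `(2π)^(-dim V)`, which is at most `1`.
  refine mul_le_of_le_one_left (integral_nonneg fun _ => norm_nonneg _) ?_
  rw [abs_inv, abs_pow, abs_neg, abs_of_pos (by positivity)]
  exact inv_le_one_of_one_le₀ (one_le_pow₀ (by linarith [Real.pi_gt_three]))

end FourierInversion

lemma IsDensity.ae_eq {k : ℕ} {μ : Measure (E k)} {g₁ g₂ : E k → ℝ} (h₁ : IsDensity μ g₁)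
    (h₂ : IsDensity μ g₂) : g₁ =ᵐ[volume] g₂ := by
  have h := (withDensity_eq_iff_of_sigmaFinite h₁.1.ennreal_ofReal.aemeasurable
    h₂.1.ennreal_ofReal.aemeasurable).1 (h₁.2.2.symm.trans h₂.2.2)
  filter_upwards [h] with x hx
  exact (ENNReal.ofReal_eq_ofReal_iff (h₁.2.1 x) (h₂.2.1 x)).1 hx

lemma IsDensity.ae_eq_fourierDensity {k : ℕ} {μ : Measure (E k)} [IsFiniteMeasure μ]
    {g : E k → ℝ} (hg : IsDensity μ g) (h : Integrable (charFun μ)) :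
    g =ᵐ[volume] fourierDensity μ :=
  hg.ae_eq ⟨(continuous_fourierDensity h).measurable, fourierDensity_nonneg h,
    eq_withDensity_fourierDensity h⟩

/-- The uniform distance of two densities is at most the `L¹` distance of the characteristic
functions. -/
theorem eLpNorm_density_sub_le {k : ℕ} {μ ν : Measure (E k)} [IsFiniteMeasure μ]
    [IsFiniteMeasure ν] {g₁ g₂ : E k → ℝ} (h₁ : IsDensity μ g₁) (h₂ : IsDensity ν g₂)
    (hμ : Integrable (charFun μ)) (hν : Integrable (charFun ν)) :
    eLpNorm (fun x => g₁ x - g₂ x) ∞ volume ≤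
      ENNReal.ofReal (∫ t, ‖charFun μ t - charFun ν t‖) := by
  rw [eLpNorm_exponent_top]
  refine eLpNormEssSup_le_of_ae_bound ?_
  filter_upwards [h₁.ae_eq_fourierDensity hμ, h₂.ae_eq_fourierDensity hν] with x hx hx'
  rw [hx, hx', Real.norm_eq_abs]
  exact abs_fourierDensity_sub_le hμ hν x

/-! ### Linear combinations of independent Stable variables -/

section Combination

variable {Ω : Type*} [MeasurableSpace Ω] {P : Measure Ω}

lemma integral_cexp_sum_stable {ι : Type*} [Fintype ι] {α : ℝ} {Z : ι → Ω → ℝ} {σ : ι → ℝ}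
    (hm : ∀ i, Measurable (Z i)) (hind : iIndepFun Z P)
    (hs : ∀ i, IsStable α (σ i) (P.map (Z i))) (c : ι → ℝ) :
    ∫ ω, Complex.exp ((∑ i, c i * Z i ω : ℝ) * Complex.I) ∂P =
      ((Real.exp (-∑ i, σ i ^ α * |c i| ^ α) : ℝ) : ℂ) := by
  have hind' : iIndepFun (fun i ω => c i * Z i ω) P :=
    hind.comp (fun i x => c i * x) fun i => measurable_const_mul _
  have h1 := congrFun (hind'.charFun_map_fun_sum_eq_prod
    (fun i => ((hm i).const_mul (c i)).aemeasurable)) 1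
  rw [charFun_apply, integral_map (by fun_prop) (by fun_prop), Finset.prod_apply] at h1
  calc _ = ∏ i, charFun (P.map fun ω => c i * Z i ω) 1 := by
        rw [← h1]; simp
    _ = ∏ i, ((Real.exp (-(σ i ^ α * |c i| ^ α)) : ℝ) : ℂ) := by
        refine Finset.prod_congr rfl fun i _ => ?_
        rw [charFun_map_mul_comp (hm i).aemeasurable, (hs i).2, mul_one]
    _ = _ := by
        rw [← Complex.ofReal_prod, ← Real.exp_sum, Finset.sum_neg_distrib]

/-- The exponent of the characteristic function of the node `∑_j w_j v_j + b 1`, whose independent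
weights and bias have the laws `St(α, σw)` and `St(α, σb)`. -/
def nodeExponent {J : Type*} [Fintype J] {k : ℕ} (α σw σb : ℝ) (v : J → E k) (t : E k) : ℝ :=
  σw ^ α * (∑ j, |inner ℝ (v j) t| ^ α) + σb ^ α * |inner ℝ (ones k) t| ^ α

/-- The joint characteristic function of finitely many nodes of a layer with the inputs `v j`. -/
lemma integral_cexp_sum_nodes {J : Type*} [Fintype J] {k : ℕ} {α σw σb : ℝ}
    {W : ℕ → J → Ω → ℝ} {B : ℕ → Ω → ℝ} (hW : ∀ i j, Measurable (W i j))
    (hB : ∀ i, Measurable (B i))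
    (hind : iIndepFun (Sum.elim (fun p : ℕ × J => W p.1 p.2) B) P)
    (hsW : ∀ i j, IsStable α σw (P.map (W i j))) (hsB : ∀ i, IsStable α σb (P.map (B i)))
    (v : J → E k) (s : Finset ℕ) (t : ℕ → E k) :
    ∫ ω, Complex.exp ((∑ i ∈ s, inner ℝ ((∑ j, W i j ω • v j) + B i ω • ones k) (t i) : ℝ)
        * Complex.I) ∂P =
      ∏ i ∈ s, ((Real.exp (-nodeExponent α σw σb v (t i)) : ℝ) : ℂ) := by
  let e : (s × J) ⊕ s → (ℕ × J) ⊕ ℕ := Sum.map (Prod.map Subtype.val id) Subtype.val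
  have he : Function.Injective e :=
    Sum.map_injective.2 ⟨Subtype.val_injective.prodMap Function.injective_id,
      Subtype.val_injective⟩
  have h := integral_cexp_sum_stable (α := α) (σ := fun p => Sum.elim (fun _ => σw) (fun _ => σb) p)
    (Z := fun p => Sum.elim (fun p : ℕ × J => W p.1 p.2) B (e p))
    (by rintro (⟨i, j⟩ | i)
        · exact hW i j
        · exact hB i)
    (hind.precomp he)
    (by rintro (⟨i, j⟩ | i)
        · exact hsW i j
        · exact hsB i)
    (Sum.elim (fun p => inner ℝ (v p.2) (t p.1)) (fun i => inner ℝ (ones k) (t i)))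
  have h1 : ∀ ω, ∑ p, Sum.elim (fun p : s × J => inner ℝ (v p.2) (t p.1))
      (fun i : s => inner ℝ (ones k) (t i)) p * Sum.elim (fun p : ℕ × J => W p.1 p.2) B (e p) ω
      = ∑ i ∈ s, inner ℝ ((∑ j, W i j ω • v j) + B i ω • ones k) (t i) := by
    intro ω
    rw [← Finset.sum_coe_sort s, Fintype.sum_sum_type, Fintype.sum_prod_type,
      ← Finset.sum_add_distrib]
    refine Finset.sum_congr rfl fun i _ => ?_
    simp [e, inner_add_left, sum_inner, inner_smul_left, mul_comm]
  have h2 : ∑ p : (s × J) ⊕ s, Sum.elim (fun _ => σw) (fun _ => σb) p ^ α *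
      |Sum.elim (fun p : s × J => inner ℝ (v p.2) (t p.1))
        (fun i : s => inner ℝ (ones k) (t i)) p| ^ α
      = ∑ i ∈ s, nodeExponent α σw σb v (t i) := by
    rw [← Finset.sum_coe_sort s, Fintype.sum_sum_type, Fintype.sum_prod_type,
      ← Finset.sum_add_distrib]
    refine Finset.sum_congr rfl fun i _ => ?_
    simp [nodeExponent, Finset.mul_sum]
  simp only [h1, h2] at h
  rw [h, ← Finset.sum_neg_distrib, Real.exp_sum, Complex.ofReal_prod]

/-- A sequence of random vectors all of whose joint characteristic functions are products of the
same function `χ` is i.i.d. with characteristic function `χ`. -/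
lemma iIndepFun_of_integral_cexp_sum [IsProbabilityMeasure P] {k : ℕ} {Y : ℕ → Ω → E k}
    (hY : ∀ i, Measurable (Y i)) {χ : E k → ℂ}
    (h : ∀ (s : Finset ℕ) (t : ℕ → E k),
      ∫ ω, Complex.exp ((∑ i ∈ s, inner ℝ (Y i ω) (t i) : ℝ) * Complex.I) ∂P = ∏ i ∈ s, χ (t i)) :
    iIndepFun Y P ∧ ∀ i t, charFun (P.map (Y i)) t = χ t := by
  have h1 : ∀ i t, charFun (P.map (Y i)) t = χ t := by
    intro i t
    have := h {i} fun _ => t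
    rw [charFun_apply, integral_map (hY i).aemeasurable (by fun_prop)]
    simpa using this
  refine ⟨iIndepFun_iff_finset.2 fun s => ?_, h1⟩
  refine (iIndepFun_iff_charFun_pi fun i : s => (hY i).aemeasurable).2 fun t => ?_
  obtain ⟨t', ht'⟩ : ∃ t' : ℕ → E k, ∀ i : s, t' i = t i :=
    ⟨fun i => if hi : i ∈ s then t ⟨i, hi⟩ else 0, fun i => dif_pos i.2⟩
  have h2 := h s t'
  have hmeas : Measurable fun ω => WithLp.toLp 2 (fun i : s => Y i ω) :=
    (WithLp.measurable_toLp 2 _).comp (measurable_pi_lambda _ fun i => hY i)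
  rw [charFun_apply]
  rw [integral_map hmeas.aemeasurable (by fun_prop)]
  rw [← Finset.prod_coe_sort s] at h2
  simp only [← Finset.sum_coe_sort s] at h2
  simp only [ht'] at h2
  simp only [h1]
  rw [← h2]
  simp [PiLp.inner_apply]

end Combination

/-! ### Freezing an independent variable -/

section Freezing

variable {Ω Ω₁ S T : Type*} [MeasurableSpace Ω] [MeasurableSpace Ω₁] [MeasurableSpace S]
  {P : Measure Ω} [IsProbabilityMeasure P] {X : Ω → Ω₁} {V : Ω → S}

lemma map_prodMk_of_indepFun (hX : Measurable X) (hV : Measurable V) (hind : IndepFun X V P) :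
    P.map (fun ω => (X ω, V ω)) = (P.map X).prod (P.map V) :=
  (indepFun_iff_map_prod_eq_prod_map_map hX.aemeasurable hV.aemeasurable).1 hind

lemma integral_comp_of_indepFun (hX : Measurable X) (hV : Measurable V) (hind : IndepFun X V P)
    {h : Ω₁ × S → ℂ} (hh : Measurable h) {C : ℝ} (hC : ∀ p, ‖h p‖ ≤ C) :
    ∫ ω, h (X ω, V ω) ∂P = ∫ ω, ∫ ω', h (X ω, V ω') ∂P ∂P := by
  have := Measure.isProbabilityMeasure_map (μ := P) hX.aemeasurable
  have := Measure.isProbabilityMeasure_map (μ := P) hV.aemeasurable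
  have hint : Integrable h ((P.map X).prod (P.map V)) :=
    Integrable.of_bound hh.aestronglyMeasurable C (ae_of_all _ hC)
  calc _ = ∫ p, h p ∂(P.map fun ω => (X ω, V ω)) :=
        (integral_map (hX.prodMk hV).aemeasurable hh.aestronglyMeasurable).symm
    _ = ∫ x, ∫ v, h (x, v) ∂(P.map V) ∂(P.map X) := by
        rw [map_prodMk_of_indepFun hX hV hind, integral_prod _ hint]
    _ = ∫ ω, ∫ v, h (X ω, v) ∂(P.map V) ∂P :=
        integral_map hX.aemeasurable
          (hh.stronglyMeasurable.integral_prod_right').aestronglyMeasurable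
    _ = _ := by
        refine integral_congr_ae (ae_of_all _ fun ω => ?_)
        exact integral_map hV.aemeasurable
          (hh.comp measurable_prodMk_left).aestronglyMeasurable

/-- The conditional law of a function of `X` and of an independent variable `V` given `X` is the
law of that function with `X` frozen. -/
lemma condDistrib_of_indepFun_freeze [MeasurableSpace T] [StandardBorelSpace T] [Nonempty T]
    (hX : Measurable X) (hV : Measurable V) (hind : IndepFun X V P)
    {H : Ω₁ → S → T} (hH : Measurable (Function.uncurry H)) :
    ∀ᵐ ω ∂P, condDistrib (fun ω => H (X ω) (V ω)) X P (X ω) =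
      P.map (fun ω' => H (X ω) (V ω')) := by
  have := Measure.isProbabilityMeasure_map (μ := P) hX.aemeasurable
  have := Measure.isProbabilityMeasure_map (μ := P) hV.aemeasurable
  let κ : Kernel Ω₁ T := (Kernel.id ×ₖ Kernel.const Ω₁ (P.map V)).map (Function.uncurry H)
  have : IsMarkovKernel κ := Kernel.IsMarkovKernel.map _ hH
  have hκ : ∀ x, κ x = P.map (fun ω' => H x (V ω')) := by
    intro x
    rw [Kernel.map_apply _ hH, Kernel.prod_apply, Kernel.id_apply, Kernel.const_apply,
      Measure.dirac_prod, Measure.map_map hH measurable_prodMk_left,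
      Measure.map_map (hH.comp measurable_prodMk_left) hV]
    rfl
  have hY : Measurable fun ω => H (X ω) (V ω) := hH.comp (hX.prodMk hV)
  have key : P.map (fun ω => (X ω, H (X ω) (V ω))) = P.map X ⊗ₘ κ := by
    ext s hs
    have hs' : MeasurableSet {p : Ω₁ × S | (p.1, H p.1 p.2) ∈ s} :=
      (measurable_fst.prodMk hH) hs
    rw [Measure.compProd_apply hs, Measure.map_apply (hX.prodMk hY) hs]
    calc _ = (P.map fun ω => (X ω, V ω)) {p : Ω₁ × S | (p.1, H p.1 p.2) ∈ s} := by
          rw [Measure.map_apply (hX.prodMk hV) hs']; rfl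
      _ = ∫⁻ x, P.map V (Prod.mk x ⁻¹' {p : Ω₁ × S | (p.1, H p.1 p.2) ∈ s}) ∂(P.map X) := by
          rw [map_prodMk_of_indepFun hX hV hind, Measure.prod_apply hs']
      _ = _ := by
          refine lintegral_congr fun x => ?_
          have h1 : Measurable fun ω' => H x (V ω') := hH.comp (measurable_prodMk_left.comp hV)
          rw [hκ, Measure.map_apply h1 (measurable_prodMk_left hs),
            Measure.map_apply hV (measurable_prodMk_left hs')]
          rfl
  have h := condDistrib_ae_eq_of_measure_eq_compProd X hY.aemeasurable key
  filter_upwards [ae_of_ae_map hX.aemeasurable h] with ω hω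
  rw [hω, hκ]

end Freezing

/-! ### Activations and empirical means -/

lemma continuous_act {k : ℕ} {φ : ℝ → ℝ} (hφ : Continuous φ) :
    Continuous (act φ : E k → E k) := by
  unfold act
  fun_prop

lemma exists_norm_act_le {φ : ℝ → ℝ} (hφ : ∃ M : ℝ, ∀ s, |φ s| ≤ M) (k : ℕ) :
    ∃ R : ℝ, 0 < R ∧ ∀ f : E k, ‖act φ f‖ ≤ R := by
  obtain ⟨M, hM⟩ := hφ
  refine ⟨√(k * M ^ 2) + 1, by positivity, fun f => ?_⟩
  rw [EuclideanSpace.norm_eq]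
  have : ∑ i, ‖act φ f i‖ ^ 2 ≤ k * M ^ 2 := by
    calc _ ≤ ∑ _i : Fin k, M ^ 2 := by
          refine Finset.sum_le_sum fun i _ => ?_
          exact pow_le_pow_left₀ (norm_nonneg _) (hM _) 2
      _ = _ := by simp
  linarith [Real.sqrt_le_sqrt this]

lemma abs_inner_rpow_le {k : ℕ} {α R : ℝ} (hα : 0 ≤ α) {a : E k} (ha : ‖a‖ ≤ R) (t : E k) :
    |inner ℝ a t| ^ α ≤ R ^ α * ‖t‖ ^ α := by
  rw [← Real.mul_rpow ((norm_nonneg a).trans ha) (norm_nonneg t)]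
  exact Real.rpow_le_rpow (abs_nonneg _) ((abs_real_inner_le_norm a t).trans
    (mul_le_mul_of_nonneg_right ha (norm_nonneg t))) hα

section StrongLaw

variable {Ω T : Type*} [MeasurableSpace Ω] [MeasurableSpace T] {P : Measure Ω}
  {Y : ℕ → Ω → T}

lemma identDistrib_comp (hY : ∀ i, Measurable (Y i))
    (hlaw : ∀ i, P.map (Y i) = P.map (Y 0)) {g : T → ℝ} (hg : Measurable g) (i : ℕ) :
    IdentDistrib (fun ω => g (Y i ω)) (fun ω => g (Y 0 ω)) P P :=
  (IdentDistrib.mk (hY i).aemeasurable (hY 0).aemeasurable (hlaw i)).comp hg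

lemma pairwise_indepFun_comp (hind : iIndepFun Y P) {g : T → ℝ} (hg : Measurable g) :
    Pairwise (Function.onFun (fun x y => IndepFun x y P) fun i ω => g (Y i ω)) :=
  fun _ _ hij => (hind.indepFun hij).comp hg hg

lemma ae_tendsto_mean [IsProbabilityMeasure P] (hY : ∀ i, Measurable (Y i)) (hind : iIndepFun Y P)
    (hlaw : ∀ i, P.map (Y i) = P.map (Y 0)) {g : T → ℝ} (hg : Measurable g) {C : ℝ}
    (hC : ∀ y, |g y| ≤ C) :
    ∀ᵐ ω ∂P, Tendsto (fun n : ℕ => (∑ j ∈ Finset.range n, g (Y j ω)) / n) atTop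
      (𝓝 (∫ y, g y ∂(P.map (Y 0)))) := by
  have hint : Integrable (fun ω => g (Y 0 ω)) P :=
    Integrable.of_bound (hg.comp (hY 0)).aestronglyMeasurable C (ae_of_all _ fun ω => hC _)
  rw [integral_map (hY 0).aemeasurable hg.aestronglyMeasurable]
  exact strong_law_ae_real (fun i ω => g (Y i ω)) hint (pairwise_indepFun_comp hind hg)
    (identDistrib_comp hY hlaw hg)

/-- The mean absolute deviation of an empirical mean of `n` bounded i.i.d. variables is
`O(n^{-1/2})`, by the Cauchy–Schwarz inequality and the additivity of the variance. -/
lemma integral_abs_mean_sub_le [IsProbabilityMeasure P] (hY : ∀ i, Measurable (Y i))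
    (hind : iIndepFun Y P) (hlaw : ∀ i, P.map (Y i) = P.map (Y 0)) {g : T → ℝ} (hg : Measurable g)
    {C : ℝ} (hC : ∀ y, |g y| ≤ C) {n : ℕ} (hn : 0 < n) :
    ∫ ω, |(∑ j ∈ Finset.range n, g (Y j ω)) / n - ∫ y, g y ∂(P.map (Y 0))| ∂P ≤
      C * (n : ℝ) ^ (-(1 / 2) : ℝ) := by
  have hn' : (0 : ℝ) < n := by exact_mod_cast hn
  obtain ⟨ω₀⟩ : Nonempty Ω := nonempty_of_isProbabilityMeasure P
  have hC0 : 0 ≤ C := (abs_nonneg _).trans (hC (Y 0 ω₀))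
  have hL : ∀ i, MemLp (fun ω => g (Y i ω)) 2 P := fun i =>
    MemLp.of_bound (hg.comp (hY i)).aestronglyMeasurable C (ae_of_all _ fun ω => hC _)
  set S : Ω → ℝ := fun ω => (∑ j ∈ Finset.range n, g (Y j ω)) / n with hS
  have hSL : MemLp S 2 P := by
    have : S = fun ω => (n : ℝ)⁻¹ * ∑ j ∈ Finset.range n, g (Y j ω) := by
      ext ω; rw [hS]; simp only; rw [div_eq_inv_mul]
    rw [this]
    exact (memLp_finsetSum _ fun i _ => hL i).const_mul _
  have hmean : ∫ ω, S ω ∂P = ∫ y, g y ∂(P.map (Y 0)) := by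
    simp only [hS]
    rw [integral_div, integral_finsetSum _ fun i _ => (hL i).integrable one_le_two,
      integral_map (hY 0).aemeasurable hg.aestronglyMeasurable,
      Finset.sum_congr rfl fun i _ => (identDistrib_comp hY hlaw hg i).integral_eq]
    simp [hn'.ne']
  have hvar : variance S P ≤ C ^ 2 / n := by
    have h1 : variance S P = ((n : ℝ)⁻¹) ^ 2 *
        variance (∑ j ∈ Finset.range n, fun ω => g (Y j ω)) P := by
      rw [← variance_const_mul]
      congr 1
      ext ω
      simp [hS, div_eq_inv_mul]
    have h2 : ∀ i, variance (fun ω => g (Y i ω)) P ≤ C ^ 2 := by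
      intro i
      refine (variance_le_expectation_sq (hL i).aestronglyMeasurable).trans ?_
      calc _ ≤ ∫ _ω, C ^ 2 ∂P := by
            refine integral_mono (hL i).integrable_sq (integrable_const _) fun ω => ?_
            exact sq_le_sq' (neg_le_of_abs_le (hC _)) (le_of_abs_le (hC _))
        _ = _ := by simp
    rw [h1, IndepFun.variance_sum (fun i _ => hL i)
      fun i _ j _ hij => pairwise_indepFun_comp hind hg hij]
    calc _ ≤ ((n : ℝ)⁻¹) ^ 2 * ∑ _j ∈ Finset.range n, C ^ 2 := by
          gcongr
          exact h2 _
      _ = _ := by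
          rw [Finset.sum_const, Finset.card_range, nsmul_eq_mul]
          field_simp
  set m := ∫ y, g y ∂(P.map (Y 0))
  have hDL : MemLp (fun ω => |S ω - m|) 2 P := (hSL.sub (memLp_const m)).abs
  have hsq : (∫ ω, |S ω - m| ∂P) ^ 2 ≤ C ^ 2 / n := by
    have h3 := variance_nonneg (fun ω => |S ω - m|) P
    rw [variance_eq_sub hDL] at h3
    have h4 : variance S P = ∫ ω, (S ω - m) ^ 2 ∂P := by
      rw [variance_eq_integral hSL.aemeasurable, hmean]
    have h5 : ∫ ω, ((fun ω => |S ω - m|) ^ 2) ω ∂P = ∫ ω, (S ω - m) ^ 2 ∂P := by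
      simp [sq_abs]
    rw [h5, ← h4] at h3
    linarith
  have hpow : (C * (n : ℝ) ^ (-(1 / 2) : ℝ)) ^ 2 = C ^ 2 / n := by
    rw [mul_pow, ← Real.rpow_natCast (_ ^ _), ← Real.rpow_mul hn'.le]
    norm_num
    rw [Real.rpow_neg_one, div_eq_mul_inv]
  exact abs_le_of_sq_le_sq' (by rw [hpow]; exact hsq) (by positivity) |>.2

end StrongLaw

/-! ### The joint law of a layer -/

/-- The exponent of the characteristic function of a node of width `n` with the inputs
`a 0, …, a (n - 1)`, scaled by `n^{-1/α}`. -/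
def empiricalExponent {k : ℕ} (α σw σb : ℝ) (a : ℕ → E k) (n : ℕ) (t : E k) : ℝ :=
  σw ^ α * ((∑ j ∈ Finset.range n, |inner ℝ (a j) t| ^ α) / n) + σb ^ α * |inner ℝ (ones k) t| ^ α

/-- The exponent of the characteristic function of a node of infinite width whose inputs are the
activations of vectors of law `q`. -/
def limitExponent {k : ℕ} (α σw σb : ℝ) (φ : ℝ → ℝ) (q : Measure (E k)) (t : E k) : ℝ :=
  σw ^ α * (∫ f, |inner ℝ (act φ f) t| ^ α ∂q) + σb ^ α * |inner ℝ (ones k) t| ^ α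

/-- A node of width `n` as a function of its inputs `f` and of the weights and biases `v` of its
layer. -/
def node {k : ℕ} (α : ℝ) (φ : ℝ → ℝ) (n i : ℕ) (f : ℕ → E k) (v : (ℕ → ℕ → ℝ) × (ℕ → ℝ)) : E k :=
  ((n : ℝ) ^ (1 / α))⁻¹ • (∑ j ∈ Finset.range n, v.1 i j • act φ (f j)) + v.2 i • ones k

lemma measurable_node {k : ℕ} (α : ℝ) {φ : ℝ → ℝ} (hφ : Continuous φ) (n i : ℕ) :
    Measurable (Function.uncurry (node (k := k) α φ n i)) := by
  have h1 : ∀ j, Measurable fun p : (ℕ → E k) × ((ℕ → ℕ → ℝ) × (ℕ → ℝ)) => act φ (p.1 j) :=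
    fun j => (continuous_act hφ).measurable.comp ((measurable_pi_apply j).comp measurable_fst)
  have h2 : ∀ j, Measurable fun p : (ℕ → E k) × ((ℕ → ℕ → ℝ) × (ℕ → ℝ)) => p.2.1 i j :=
    fun j => by fun_prop
  have h3 : Measurable fun p : (ℕ → E k) × ((ℕ → ℕ → ℝ) × (ℕ → ℝ)) => p.2.2 i := by fun_prop
  unfold Function.uncurry node
  exact ((Finset.measurable_sum _ fun j _ => (h2 j).smul (h1 j)).const_smul
    (((n : ℝ) ^ (1 / α))⁻¹)).add (h3.smul_const (ones k))

lemma nodeExponent_eq_empiricalExponent {k : ℕ} {α : ℝ} (hα : 0 < α) (σw σb : ℝ) (a : ℕ → E k)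
    (n : ℕ) (t : E k) :
    nodeExponent α σw σb (fun j : Fin n => ((n : ℝ) ^ (1 / α))⁻¹ • a j) t =
      empiricalExponent α σw σb a n t := by
  have h : ∀ j, |inner ℝ (((n : ℝ) ^ (1 / α))⁻¹ • a j) t| ^ α = |inner ℝ (a j) t| ^ α / n := by
    intro j
    rw [real_inner_smul_left, abs_mul, Real.mul_rpow (abs_nonneg _) (abs_nonneg _),
      abs_of_nonneg (by positivity), Real.inv_rpow (by positivity),
      ← Real.rpow_mul (Nat.cast_nonneg n), one_div_mul_cancel hα.ne', Real.rpow_one,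
      div_eq_inv_mul]
  simp only [nodeExponent, empiricalExponent, h]
  rw [Finset.sum_div, Finset.sum_range]

section Measurability

variable {Ω : Type*} {k : ℕ}

lemma measurable_past {F : ℕ → ℕ → Ω → E k} {l l' : ℕ} (hl' : l' ∈ Set.Icc 1 l) :
    Measurable[past F l] fun ω i => F l' i ω := by
  let _ := past F l
  refine measurable_pi_lambda _ fun i => ?_
  rw [measurable_iff_comap_le]
  exact le_iSup₂_of_le (f := fun l' _ => ⨆ i, MeasurableSpace.comap (F l' i) inferInstance) l' hl'
    (le_iSup (fun i => MeasurableSpace.comap (F l' i) inferInstance) i)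

/-- All the weights and biases of layer `l`, as one random variable. -/
def layerParams (w : ℕ → ℕ → ℕ → Ω → ℝ) (b : ℕ → ℕ → Ω → ℝ) (l : ℕ) (ω : Ω) :
    (ℕ → ℕ → ℝ) × (ℕ → ℝ) :=
  (fun i j => w l i j ω, fun i => b l i ω)

lemma measurable_layerParams_layerSigma {w : ℕ → ℕ → ℕ → Ω → ℝ} {b : ℕ → ℕ → Ω → ℝ} {l : ℕ} :
    Measurable[layerSigma w b l] (layerParams w b l) := by
  let _ := layerSigma w b l
  refine Measurable.prodMk (measurable_pi_lambda _ fun i => measurable_pi_lambda _ fun j => ?_)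
    (measurable_pi_lambda _ fun i => ?_)
  · rw [measurable_iff_comap_le]
    exact le_sup_of_le_left (le_iSup₂ (f := fun i j =>
      MeasurableSpace.comap (w l i j) inferInstance) i j)
  · rw [measurable_iff_comap_le]
    exact le_sup_of_le_right (le_iSup (fun i => MeasurableSpace.comap (b l i) inferInstance) i)

lemma layer_eq_node {α : ℝ} {φ : ℝ → ℝ} {I : ℕ} {X : Matrix (Fin I) (Fin k) ℝ}
    {w₁ : ℕ → Fin I → Ω → ℝ} {w : ℕ → ℕ → ℕ → Ω → ℝ} {b : ℕ → ℕ → Ω → ℝ} {F : ℕ → ℕ → Ω → E k}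
    (l n i : ℕ) (ω : Ω) :
    layer α φ X w₁ w b F (l + 2) n i ω =
      node α φ n i (fun j => F (l + 1) j ω) (layerParams w b (l + 2) ω) := rfl

end Measurability

section Network

variable {Ω : Type*} [MeasurableSpace Ω] {P : Measure Ω} [IsProbabilityMeasure P]
  {α σw σb : ℝ} {φ : ℝ → ℝ} {I k D : ℕ} {X : Matrix (Fin I) (Fin k) ℝ}
  {w₁ : ℕ → Fin I → Ω → ℝ} {w : ℕ → ℕ → ℕ → Ω → ℝ} {b : ℕ → ℕ → Ω → ℝ} {F : ℕ → ℕ → Ω → E k}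

namespace IsSequentialNN

lemma measurable_weight (h : IsSequentialNN P α σw σb φ X D w₁ w b F) {l : ℕ}
    (hl : l ∈ Set.Icc 2 D) (i j : ℕ) : Measurable (w l i j) :=
  h.measurable_params (.weight ⟨l, hl⟩ i j)

lemma measurable_bias (h : IsSequentialNN P α σw σb φ X D w₁ w b F) {l : ℕ}
    (hl : l ∈ Set.Icc 1 D) (i : ℕ) : Measurable (b l i) :=
  h.measurable_params (.bias ⟨l, hl⟩ i)

lemma measurable_layerParams (h : IsSequentialNN P α σw σb φ X D w₁ w b F) {l : ℕ}
    (hl : l ∈ Set.Icc 2 D) : Measurable (layerParams w b l) :=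
  (measurable_pi_lambda _ fun i => measurable_pi_lambda _ fun j => h.measurable_weight hl i j).prodMk
    (measurable_pi_lambda _ fun i => h.measurable_bias ⟨by have := hl.1; omega, hl.2⟩ i)

lemma past_le (h : IsSequentialNN P α σw σb φ X D w₁ w b F) {l : ℕ} (hl : l ≤ D) :
    past F l ≤ ‹MeasurableSpace Ω› :=
  iSup₂_le fun l' hl' => iSup_le fun i => (h.measurable_limit l' ⟨hl'.1, hl'.2.trans hl⟩ i).comap_le

lemma indepFun_layerParams (h : IsSequentialNN P α σw σb φ X D w₁ w b F) {l : ℕ}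
    (hl : l ∈ Set.Icc 2 D) :
    @IndepFun Ω Ω _ _ (past F (l - 1)) _ id (layerParams w b l) P := by
  have h2 := indep_of_indep_of_le_left (h.indep_past l hl) measurable_layerParams_layerSigma.comap_le
  refine (@IndepFun_iff_Indep Ω Ω _ _ (past F (l - 1)) _ id (layerParams w b l) P).2 ?_
  rw [MeasurableSpace.comap_id]
  exact h2.symm

/-- Given the inputs, the nodes of a layer of width `n` are independent, with the characteristic
function `exp (-empiricalExponent)`. -/
lemma integral_cexp_sum_node (h : IsSequentialNN P α σw σb φ X D w₁ w b F) (hα : 0 < α) {l : ℕ}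
    (hl : l ∈ Set.Icc 2 D) (n : ℕ) (f : ℕ → E k) (s : Finset ℕ) (t : ℕ → E k) :
    ∫ ω, Complex.exp ((∑ i ∈ s, inner ℝ (node α φ n i f (layerParams w b l ω)) (t i) : ℝ)
        * Complex.I) ∂P =
      ∏ i ∈ s, ((Real.exp (-empiricalExponent α σw σb (fun j => act φ (f j)) n (t i)) : ℝ) : ℂ) := by
  have hl1 : l ∈ Set.Icc 1 D := ⟨by have := hl.1; omega, hl.2⟩
  let g : (ℕ × Fin n) ⊕ ℕ → Param D I :=
    Sum.elim (fun p => .weight ⟨l, hl⟩ p.1 p.2) (fun i => .bias ⟨l, hl1⟩ i)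
  have hg : Function.Injective g := by
    rintro (⟨i, j⟩ | i) (⟨i', j'⟩ | i') hij <;> simp_all [g, Fin.ext_iff]
  have hind := h.indep_params.precomp hg
  have heq : (fun p => params D w₁ w b (g p)) =
      Sum.elim (fun p : ℕ × Fin n => (fun i (j : Fin n) => w l i j) p.1 p.2) (b l) := by
    funext p
    rcases p with ⟨i, j⟩ | i <;> rfl
  rw [heq] at hind
  have := integral_cexp_sum_nodes (fun i (j : Fin n) => h.measurable_weight hl i j)
    (h.measurable_bias hl1) hind (fun i j => h.law_weight l hl i j) (h.law_bias l hl1)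
    (fun j : Fin n => ((n : ℝ) ^ (1 / α))⁻¹ • act φ (f j)) s t
  simp only [nodeExponent_eq_empiricalExponent hα σw σb (fun j => act φ (f j))] at this
  rw [← this]
  refine integral_congr_ae (ae_of_all _ fun ω => ?_)
  simp only [node, layerParams, Finset.smul_sum, Finset.sum_range, smul_comm (_ : ℝ)⁻¹ (_ : ℝ)]

lemma integral_cexp_sum_layer (h : IsSequentialNN P α σw σb φ X D w₁ w b F) (hα : 0 < α)
    (hφ : Continuous φ) {l : ℕ} (hl : l + 2 ∈ Set.Icc 2 D) (n : ℕ) (s : Finset ℕ) (t : ℕ → E k) :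
    ∫ ω, Complex.exp ((∑ i ∈ s, inner ℝ (layer α φ X w₁ w b F (l + 2) n i ω) (t i) : ℝ)
        * Complex.I) ∂P =
      ∫ ω, ∏ i ∈ s, ((Real.exp (-empiricalExponent α σw σb (fun j => act φ (F (l + 1) j ω)) n
        (t i)) : ℝ) : ℂ) ∂P := by
  have hlD : l + 1 ≤ D := by have := hl.2; omega
  have hpast := measurable_past (F := F) (l := l + 1) (l' := l + 1) ⟨by omega, le_rfl⟩
  have hX : Measurable fun ω i => F (l + 1) i ω := hpast.mono (h.past_le hlD) le_rfl
  have hind : IndepFun (fun ω i => F (l + 1) i ω) (layerParams w b (l + 2)) P :=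
    IndepFun.comp (h.indepFun_layerParams hl) hpast measurable_id
  have hn : ∀ i, Measurable fun p : (ℕ → E k) × ((ℕ → ℕ → ℝ) × (ℕ → ℝ)) => node α φ n i p.1 p.2 :=
    fun i => measurable_node α hφ n i
  have hH : Measurable fun p : (ℕ → E k) × ((ℕ → ℕ → ℝ) × (ℕ → ℝ)) =>
      Complex.exp ((∑ i ∈ s, inner ℝ (node α φ n i p.1 p.2) (t i) : ℝ) * Complex.I) := by
    have : Measurable fun p : (ℕ → E k) × ((ℕ → ℕ → ℝ) × (ℕ → ℝ)) =>
        (∑ i ∈ s, inner ℝ (node α φ n i p.1 p.2) (t i) : ℝ) :=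
      Finset.measurable_sum _ fun i _ => (hn i).inner_const
    fun_prop
  have := integral_comp_of_indepFun hX (h.measurable_layerParams hl) hind hH (C := 1)
    fun p => (Complex.norm_exp_ofReal_mul_I _).le
  simp only [layer_eq_node]
  rw [this]
  refine integral_congr_ae (ae_of_all _ fun ω => ?_)
  exact h.integral_cexp_sum_node hα hl n _ s t

/-- The conditional law of a node given the previous layers is the law of the node with its inputs
frozen. -/
lemma condLaw_layer_ae_eq (h : IsSequentialNN P α σw σb φ X D w₁ w b F)
    (hφ : Continuous φ) {l : ℕ} (hl : l + 2 ∈ Set.Icc 2 D) (n i : ℕ) :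
    ∀ᵐ ω ∂P, condLaw P (past F (l + 1)) (layer α φ X w₁ w b F (l + 2) n i) ω =
      P.map (fun ω' => node α φ n i (fun j => F (l + 1) j ω) (layerParams w b (l + 2) ω')) := by
  have hlD : l + 1 ≤ D := by have := hl.2; omega
  have hpast := measurable_past (F := F) (l := l + 1) (l' := l + 1) ⟨by omega, le_rfl⟩
  have hH : @Measurable _ _ (@Prod.instMeasurableSpace _ _ (past F (l + 1)) _) _
      (Function.uncurry fun ω v => node α φ n i (fun j => F (l + 1) j ω) v) := by
    refine (measurable_node α hφ n i).comp (f := fun p : Ω × ((ℕ → ℕ → ℝ) × (ℕ → ℝ)) =>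
      ((fun j => F (l + 1) j p.1), p.2)) ?_
    exact Measurable.prodMk (hpast.comp (@measurable_fst _ _ (past F (l + 1)) _))
      (@measurable_snd _ _ (past F (l + 1)) _)
  have hid : @Measurable Ω Ω _ (past F (l + 1)) id := measurable_id'' (h.past_le hlD)
  have hind := h.indepFun_layerParams hl
  have hV := h.measurable_layerParams hl
  have key := @condDistrib_of_indepFun_freeze Ω Ω ((ℕ → ℕ → ℝ) × (ℕ → ℝ)) (E k) _
    (past F (l + 1)) _ P _ id (layerParams w b (l + 2)) _ _ _
    hid hV hind
    (fun ω v => node α φ n i (fun j => F (l + 1) j ω) v) hH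
  exact key

lemma charFun_frozen_node (h : IsSequentialNN P α σw σb φ X D w₁ w b F) (hα : 0 < α)
    (hφ : Continuous φ) {l : ℕ} (hl : l ∈ Set.Icc 2 D) (n i : ℕ) (f : ℕ → E k) (t : E k) :
    charFun (P.map (fun ω' => node α φ n i f (layerParams w b l ω'))) t =
      ((Real.exp (-empiricalExponent α σw σb (fun j => act φ (f j)) n t) : ℝ) : ℂ) := by
  have hm : Measurable (fun ω' => node α φ n i f (layerParams w b l ω')) :=
    (measurable_node α hφ n i).comp (f := fun ω' => (f, layerParams w b l ω'))
      (measurable_const.prodMk (h.measurable_layerParams hl))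
  have := h.integral_cexp_sum_node hα hl n f {i} fun _ => t
  simp only [Finset.sum_singleton, Finset.prod_singleton] at this
  rw [charFun_apply, integral_map hm.aemeasurable (by fun_prop), this]

lemma integral_cexp_sum_firstLayer (h : IsSequentialNN P α σw σb φ X D w₁ w b F) (hD : 1 ≤ D)
    (s : Finset ℕ) (t : ℕ → E k) :
    ∫ ω, Complex.exp ((∑ i ∈ s, inner ℝ (F 1 i ω) (t i) : ℝ) * Complex.I) ∂P =
      ∏ i ∈ s, ((Real.exp (-nodeExponent α σw σb (row X) (t i)) : ℝ) : ℂ) := by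
  have hl1 : 1 ∈ Set.Icc 1 D := ⟨le_rfl, hD⟩
  let g : (ℕ × Fin I) ⊕ ℕ → Param D I :=
    Sum.elim (fun p => .inputWeight p.1 p.2) (fun i => .bias ⟨1, hl1⟩ i)
  have hg : Function.Injective g := by
    rintro (⟨i, j⟩ | i) (⟨i', j'⟩ | i') hij <;> simp_all [g]
  have hind := h.indep_params.precomp hg
  have heq : (fun p => params D w₁ w b (g p)) =
      Sum.elim (fun p : ℕ × Fin I => w₁ p.1 p.2) (b 1) := by
    funext p
    rcases p with ⟨i, j⟩ | i <;> rfl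
  rw [heq] at hind
  rw [h.limit_one]
  exact integral_cexp_sum_nodes (fun i j => h.measurable_params (.inputWeight i j))
    (h.measurable_bias hl1) hind h.law_inputWeight (h.law_bias 1 hl1) (row X) s t

end IsSequentialNN

end Network

/-! ### The limit of a layer -/

/-- The exponents of the characteristic functions of the limiting layers. Layers are numbered from
`1`, so the value at `0` is irrelevant. -/
def networkExponent {Ω : Type*} [MeasurableSpace Ω] (P : Measure Ω) (α σw σb : ℝ) (φ : ℝ → ℝ)
    {I k : ℕ} (X : Matrix (Fin I) (Fin k) ℝ) (F : ℕ → ℕ → Ω → E k) : ℕ → E k → ℝ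
  | 0 => 0
  | 1 => nodeExponent α σw σb (row X)
  | l + 2 => limitExponent α σw σb φ (P.map (F (l + 1) 0))

section Limit

variable {Ω : Type*} [MeasurableSpace Ω] {P : Measure Ω} [IsProbabilityMeasure P]
  {α σw σb : ℝ} {φ : ℝ → ℝ} {I k D : ℕ} {X : Matrix (Fin I) (Fin k) ℝ}
  {w₁ : ℕ → Fin I → Ω → ℝ} {w : ℕ → ℕ → ℕ → Ω → ℝ} {b : ℕ → ℕ → Ω → ℝ} {F : ℕ → ℕ → Ω → E k}

lemma measurable_abs_inner_act_rpow (α : ℝ) (hφ : Continuous φ) (t : E k) :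
    Measurable fun f : E k => |inner ℝ (act φ f) t| ^ α := by
  have := (continuous_act (k := k) hφ).measurable
  fun_prop

lemma ae_tendsto_empiricalExponent {Y : ℕ → Ω → E k} (hY : ∀ i, Measurable (Y i))
    (hind : iIndepFun Y P) (hlaw : ∀ i, P.map (Y i) = P.map (Y 0)) (hα : 0 < α)
    (hφ : Continuous φ) (hφb : ∃ M : ℝ, ∀ s, |φ s| ≤ M) (t : E k) :
    ∀ᵐ ω ∂P, Tendsto (fun n => empiricalExponent α σw σb (fun j => act φ (Y j ω)) n t) atTop
      (𝓝 (limitExponent α σw σb φ (P.map (Y 0)) t)) := by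
  obtain ⟨R, hR, hbd⟩ := exists_norm_act_le hφb k
  filter_upwards [ae_tendsto_mean hY hind hlaw (measurable_abs_inner_act_rpow α hφ t)
    (C := R ^ α * ‖t‖ ^ α) fun f => by
      rw [abs_of_nonneg (by positivity)]
      exact abs_inner_rpow_le hα.le (hbd f) t] with ω hω
  exact (hω.const_mul _).add_const _

lemma empiricalExponent_nonneg (hw : 0 ≤ σw) (hb : 0 ≤ σb) (a : ℕ → E k) (n : ℕ) (t : E k) :
    0 ≤ empiricalExponent α σw σb a n t := by
  unfold empiricalExponent; positivity

lemma measurable_empiricalExponent {Y : ℕ → Ω → E k} (hY : ∀ i, Measurable (Y i))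
    (hφ : Continuous φ) (n : ℕ) (t : E k) :
    Measurable fun ω => empiricalExponent α σw σb (fun j => act φ (Y j ω)) n t := by
  unfold empiricalExponent
  exact (((Finset.measurable_sum _ fun j _ =>
    (measurable_abs_inner_act_rpow α hφ t).comp (hY j)).div_const _).const_mul _).add_const _

lemma tendsto_integral_cexp_sum {Z : ℕ → Ω → ℕ → E k} {Y : Ω → ℕ → E k}
    (h : TendstoInDistribution Z atTop Y (fun _ => P) P) (s : Finset ℕ) (t : ℕ → E k) :
    Tendsto (fun n => ∫ ω, Complex.exp ((∑ i ∈ s, inner ℝ (Z n ω i) (t i) : ℝ) * Complex.I) ∂P)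
      atTop (𝓝 (∫ ω, Complex.exp ((∑ i ∈ s, inner ℝ (Y ω i) (t i) : ℝ) * Complex.I) ∂P)) := by
  have hg : Continuous fun y : ℕ → E k => ∑ i ∈ s, inner ℝ (y i) (t i) := by fun_prop
  have h1 := h.continuous_comp hg
  have h2 := ProbabilityMeasure.tendsto_iff_tendsto_charFun.1 h1.tendsto 1
  simp only [ProbabilityMeasure.coe_mk] at h2
  have h3 : ∀ G : Ω → ℝ, AEMeasurable G P →
      charFun (P.map G) 1 = ∫ ω, Complex.exp ((G ω : ℝ) * Complex.I) ∂P := by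
    intro G hG
    rw [charFun_apply, integral_map hG (by fun_prop)]
    simp
  rw [h3 _ h1.aemeasurable_limit] at h2
  refine h2.congr fun n => ?_
  rw [h3 _ (h1.forall_aemeasurable n)]
  rfl

namespace IsSequentialNN

/-- The limit of layer `l` is i.i.d., with characteristic function `exp (-networkExponent)`. By
induction on the layer: the conditional characteristic functions of the nodes of width `n` converge
by the strong law of large numbers applied to the previous layer. -/
theorem iIndepFun_limit (h : IsSequentialNN P α σw σb φ X D w₁ w b F) (hα : 0 < α) (hw : 0 ≤ σw)
    (hb : 0 ≤ σb) (hφ : Continuous φ) (hφb : ∃ M : ℝ, ∀ s, |φ s| ≤ M) (l : ℕ)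
    (hl : l + 1 ∈ Set.Icc 1 D) :
    iIndepFun (F (l + 1)) P ∧ ∀ i t, charFun (P.map (F (l + 1) i)) t =
      ((Real.exp (-networkExponent P α σw σb φ X F (l + 1) t) : ℝ) : ℂ) := by
  induction l with
  | zero =>
    exact iIndepFun_of_integral_cexp_sum (h.measurable_limit 1 hl)
      (h.integral_cexp_sum_firstLayer hl.2)
  | succ l ih =>
    have hl' : l + 1 ∈ Set.Icc 1 D := ⟨by omega, by have := hl.2; omega⟩
    have hl2 : l + 2 ∈ Set.Icc 2 D := ⟨by omega, hl.2⟩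
    obtain ⟨hind, hchar⟩ := ih hl'
    have hY := h.measurable_limit (l + 1) hl'
    have hlaw : ∀ i, P.map (F (l + 1) i) = P.map (F (l + 1) 0) := by
      intro i
      have := Measure.isProbabilityMeasure_map (μ := P) (hY i).aemeasurable
      have := Measure.isProbabilityMeasure_map (μ := P) (hY 0).aemeasurable
      exact Measure.ext_of_charFun (funext fun t => by rw [hchar, hchar])
    refine iIndepFun_of_integral_cexp_sum (h.measurable_limit _ hl) fun s t => ?_
    have h1 := tendsto_integral_cexp_sum (h.limit_layer _ hl2) s t
    simp only [h.integral_cexp_sum_layer hα hφ hl2] at h1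
    refine tendsto_nhds_unique h1 ?_
    have h2 : ∫ _ω, ∏ i ∈ s, ((Real.exp (-networkExponent P α σw σb φ X F (l + 2) (t i)) : ℝ) : ℂ) ∂P
        = ∏ i ∈ s, ((Real.exp (-networkExponent P α σw σb φ X F (l + 2) (t i)) : ℝ) : ℂ) := by
      simp
    rw [← h2]
    refine tendsto_integral_of_dominated_convergence (fun _ => 1) (fun n => ?_)
      (integrable_const _) (fun n => ae_of_all _ fun ω => ?_) ?_
    · refine (Finset.measurable_prod _ fun i _ => ?_).aestronglyMeasurable
      have := measurable_empiricalExponent (α := α) (σw := σw) (σb := σb) hY hφ n (t i)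
      fun_prop
    · rw [← Complex.ofReal_prod, Complex.norm_real, Real.norm_of_nonneg
        (Finset.prod_nonneg fun _ _ => (Real.exp_pos _).le)]
      refine Finset.prod_le_one (fun _ _ => (Real.exp_pos _).le) fun i _ => ?_
      exact Real.exp_le_one_iff.2 (neg_nonpos.2 (empiricalExponent_nonneg hw hb _ _ _))
    · have h3 : ∀ i, ∀ᵐ ω ∂P, Tendsto (fun n => empiricalExponent α σw σb
          (fun j => act φ (F (l + 1) j ω)) n (t i)) atTop
          (𝓝 (limitExponent α σw σb φ (P.map (F (l + 1) 0)) (t i))) :=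
        fun i => ae_tendsto_empiricalExponent hY hind hlaw hα hφ hφb (t i)
      filter_upwards [ae_all_iff.2 h3] with ω hω
      refine tendsto_finsetProd _ fun i _ => ?_
      exact (Complex.continuous_ofReal.tendsto _).comp
        ((Real.continuous_exp.tendsto _).comp (hω i).neg)

end IsSequentialNN

end Limit

/-! ### The spectral measures -/

section Spectral

variable {k : ℕ}

/-- The measure `‖c h‖^α ζ_h` represents the function `t ↦ |⟨c h, t⟩|^α`; this includes `h = 0`, as
`α ≠ 0`. -/
lemma lintegral_zeta {α c : ℝ} (hα : 0 < α) (hc : 0 ≤ c) (h t : E k) :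
    ENNReal.ofReal (c ^ α * ‖h‖ ^ α) * ∫⁻ s, ENNReal.ofReal (|inner ℝ s t| ^ α) ∂(zeta h) =
      ENNReal.ofReal (c ^ α * |inner ℝ h t| ^ α) := by
  by_cases hh : h = 0
  · simp [hh, zeta, Real.zero_rpow hα.ne']
  · have hn : 0 < ‖h‖ := norm_pos_iff.2 hh
    have h1 : |inner ℝ (‖h‖⁻¹ • h) t| ^ α = (‖h‖ ^ α)⁻¹ * |inner ℝ h t| ^ α := by
      rw [real_inner_smul_left, abs_mul, Real.mul_rpow (abs_nonneg _) (abs_nonneg _),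
        abs_of_pos (inv_pos.2 hn), Real.inv_rpow hn.le]
    rw [zeta, if_neg hh, lintegral_smul_measure, lintegral_add_measure, lintegral_dirac,
      lintegral_dirac, inner_neg_left, abs_neg, h1, ← two_mul, smul_eq_mul, ← mul_assoc 2⁻¹,
      ENNReal.inv_mul_cancel (by norm_num) (by norm_num), one_mul,
      ← ENNReal.ofReal_mul (by positivity)]
    congr 1
    have : ‖h‖ ^ α ≠ 0 := (Real.rpow_pos_of_pos hn α).ne'
    field_simp

lemma zeta_univ_le (h : E k) : zeta h Set.univ ≤ 1 := by
  unfold zeta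
  split_ifs
  · simp
  · simp [← two_mul]

lemma zeta_compl_sphere (h : E k) : zeta h (Metric.sphere 0 1)ᶜ = 0 := by
  unfold zeta
  split_ifs with hh
  · simp
  · simp [norm_smul, hh]

lemma measurable_zeta : Measurable (zeta : E k → Measure (E k)) := by
  refine Measure.measurable_of_measurable_coe _ fun s hs => ?_
  have h1 : Measurable fun h : E k => ‖h‖⁻¹ • h := by fun_prop
  have h2 : Measurable (s.indicator (1 : E k → ℝ≥0∞)) := measurable_one.indicator hs
  have h3 : (fun h : E k => zeta h s) = fun h => open Classical in
      if h = 0 then 0 else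
        2⁻¹ * (s.indicator 1 (‖h‖⁻¹ • h) + s.indicator 1 (-(‖h‖⁻¹ • h))) := by
    ext h
    unfold zeta
    split_ifs
    · simp
    · simp [Measure.dirac_apply' _ hs, mul_add]
  rw [h3]
  classical
  exact Measurable.ite (measurableSet_singleton 0) measurable_const
    (((h2.comp h1).add (h2.comp h1.neg)).const_mul _)

variable {Ω : Type*} [MeasurableSpace Ω] {P : Measure Ω}
  {α σw σb : ℝ} {φ : ℝ → ℝ} {I : ℕ} {X : Matrix (Fin I) (Fin k) ℝ} {F : ℕ → ℕ → Ω → E k}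

lemma measurable_smul_zeta_act (α σw : ℝ) (hφ : Continuous φ) :
    Measurable fun f : E k => ENNReal.ofReal (‖σw • act φ f‖ ^ α) • zeta (act φ f) := by
  have hact := (continuous_act (k := k) hφ).measurable
  refine Measure.measurable_of_measurable_coe _ fun s hs => ?_
  have h1 : Measurable fun f : E k => zeta (act φ f) s :=
    (Measure.measurable_coe hs).comp (measurable_zeta.comp hact)
  have h2 : Measurable fun f : E k => ENNReal.ofReal (‖σw • act φ f‖ ^ α) := by fun_prop
  exact h2.mul h1

lemma norm_smul_rpow {c : ℝ} (hc : 0 ≤ c) (α : ℝ) (h : E k) :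
    ‖c • h‖ ^ α = c ^ α * ‖h‖ ^ α := by
  rw [norm_smul, Real.norm_of_nonneg hc, Real.mul_rpow hc (norm_nonneg h)]

/-- The spectral measure of a layer represents the exponent of its characteristic function. -/
lemma lintegral_spectral [IsFiniteMeasure P] (hα : 0 < α) (hw : 0 ≤ σw) (hb : 0 ≤ σb)
    (hφ : Continuous φ)
    (hφb : ∃ M : ℝ, ∀ s, |φ s| ≤ M) {l : ℕ} (t : E k) :
    ∫⁻ s, ENNReal.ofReal (|inner ℝ s t| ^ α) ∂(spectral P α σw σb φ X F (l + 1)) =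
      ENNReal.ofReal (networkExponent P α σw σb φ X F (l + 1) t) := by
  rcases l with _ | l
  · simp only [spectral, networkExponent, nodeExponent]
    rw [lintegral_add_measure, lintegral_smul_measure, lintegral_finsetSum_measure,
      norm_smul_rpow hb, smul_eq_mul, lintegral_zeta hα hb,
      add_comm (σw ^ α * _), ENNReal.ofReal_add (by positivity) (by positivity), Finset.mul_sum,
      ENNReal.ofReal_sum_of_nonneg fun _ _ => by positivity]
    congr 1
    refine Finset.sum_congr rfl fun j _ => ?_
    rw [lintegral_smul_measure, smul_eq_mul, lintegral_zeta hα hw]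
  · simp only [spectral, networkExponent, limitExponent]
    obtain ⟨R, hR, hbd⟩ := exists_norm_act_le hφb k
    have hm := measurable_abs_inner_act_rpow α hφ t
    have hint : Integrable (fun f : E k => |inner ℝ (act φ f) t| ^ α) (P.map (F (l + 1) 0)) := by
      refine Integrable.of_bound hm.aestronglyMeasurable (R ^ α * ‖t‖ ^ α) (ae_of_all _ fun f => ?_)
      rw [Real.norm_of_nonneg (by positivity)]
      exact abs_inner_rpow_le hα.le (hbd f) t
    have hnn : 0 ≤ ∫ f, |inner ℝ (act φ f) t| ^ α ∂(P.map (F (l + 1) 0)) :=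
      integral_nonneg fun f => by positivity
    rw [lintegral_add_measure, lintegral_smul_measure, norm_smul_rpow hb, smul_eq_mul,
      lintegral_zeta hα hb, add_comm (σw ^ α * _), ENNReal.ofReal_add (by positivity) (by positivity),
      Measure.lintegral_bind (measurable_smul_zeta_act α σw hφ).aemeasurable (by fun_prop),
      ← integral_const_mul, ofReal_integral_eq_lintegral_ofReal (hint.const_mul _)
        (ae_of_all _ fun f => by positivity)]
    congr 1
    refine lintegral_congr fun f => ?_
    rw [lintegral_smul_measure, smul_eq_mul, norm_smul_rpow hw, lintegral_zeta hα hw]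

lemma spectral_compl_sphere (hφ : Continuous φ) (l : ℕ) :
    spectral P α σw σb φ X F l (Metric.sphere 0 1)ᶜ = 0 := by
  rcases l with _ | _ | l
  · simp [spectral]
  · simp [spectral, zeta_compl_sphere]
  · simp only [spectral, Measure.add_apply, Measure.smul_apply, zeta_compl_sphere]
    rw [Measure.bind_apply Metric.isClosed_sphere.measurableSet.compl
      (measurable_smul_zeta_act α σw hφ).aemeasurable]
    simp [zeta_compl_sphere]

lemma isFiniteMeasure_spectral [IsFiniteMeasure P] (hα : 0 < α) (hw : 0 ≤ σw) (hφ : Continuous φ)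
    (hφb : ∃ M : ℝ, ∀ s, |φ s| ≤ M) (l : ℕ) :
    IsFiniteMeasure (spectral P α σw σb φ X F l) := by
  have hfin : ∀ h : E k, zeta h Set.univ < ∞ := fun h => (zeta_univ_le h).trans_lt ENNReal.one_lt_top
  rcases l with _ | _ | l
  · simp only [spectral]; infer_instance
  · refine ⟨?_⟩
    simp only [spectral, Measure.add_apply, Measure.smul_apply, Measure.finsetSum_apply, smul_eq_mul]
    exact ENNReal.add_lt_top.2 ⟨ENNReal.mul_lt_top ENNReal.ofReal_lt_top (hfin _),
      ENNReal.sum_lt_top.2 fun j _ => ENNReal.mul_lt_top ENNReal.ofReal_lt_top (hfin _)⟩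
  · refine ⟨?_⟩
    simp only [spectral, Measure.add_apply, Measure.smul_apply, smul_eq_mul]
    refine ENNReal.add_lt_top.2 ⟨ENNReal.mul_lt_top ENNReal.ofReal_lt_top (hfin _), ?_⟩
    rw [Measure.bind_apply MeasurableSet.univ (measurable_smul_zeta_act α σw hφ).aemeasurable]
    obtain ⟨R, hR, hbd⟩ := exists_norm_act_le hφb k
    have hfinite : IsFiniteMeasure (P.map (F (l + 1) 0)) := inferInstance
    calc _ ≤ ∫⁻ _f, ENNReal.ofReal (σw ^ α * R ^ α) ∂(P.map (F (l + 1) 0)) := by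
          refine lintegral_mono fun f => ?_
          rw [Measure.smul_apply, smul_eq_mul, norm_smul_rpow hw]
          refine (mul_le_of_le_one_right' (zeta_univ_le _)).trans (ENNReal.ofReal_le_ofReal ?_)
          have := Real.rpow_le_rpow (norm_nonneg _) (hbd f) hα.le
          gcongr
      _ < ∞ := by
          rw [lintegral_const]
          exact ENNReal.mul_lt_top ENNReal.ofReal_lt_top (measure_lt_top _ _)

lemma isStableVec_spectral [IsFiniteMeasure P] (hα : 0 < α) (hw : 0 ≤ σw) (hb : 0 ≤ σb)
    (hφ : Continuous φ)
    (hφb : ∃ M : ℝ, ∀ s, |φ s| ≤ M) {l : ℕ} {μ : Measure (E k)}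
    [IsProbabilityMeasure μ] (hμ : ∀ t, charFun μ t =
      ((Real.exp (-networkExponent P α σw σb φ X F (l + 1) t) : ℝ) : ℂ)) :
    IsStableVec α (spectral P α σw σb φ X F (l + 1)) μ := by
  refine ⟨inferInstance, isFiniteMeasure_spectral hα hw hφ hφb _, spectral_compl_sphere hφ _,
    fun t => ?_⟩
  rw [hμ t, Measure.restrict_eq_self_of_ae_mem (s := Metric.sphere (0 : E k) 1)
    (by rw [ae_iff]; exact spectral_compl_sphere hφ _),
    integral_eq_lintegral_of_nonneg_ae (ae_of_all _ fun s => by positivity)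
      (by have : Measurable fun s : E k => |inner ℝ s t| ^ α := by fun_prop
          exact this.aestronglyMeasurable), lintegral_spectral hα hw hb hφ hφb, ENNReal.toReal_ofReal]
  rcases l with _ | l
  · simp only [networkExponent, nodeExponent]; positivity
  · have : 0 ≤ ∫ f, |inner ℝ (act φ f) t| ^ α ∂(P.map (F (l + 1) 0)) :=
      integral_nonneg fun f => by positivity
    simp only [networkExponent, limitExponent]; positivity

end Spectral

/-! ### Lower bounds for the exponents -/

section LowerBound

variable {k : ℕ}

/-- A continuous homogeneous function that is positive off the origin is bounded below by a multiple
of a power of the norm: compare on the unit sphere. -/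
lemma exists_mul_rpow_norm_le {f : E k → ℝ} {β : ℝ} (hβ : 0 < β) (hf : Continuous f)
    (hom : ∀ r : ℝ, 0 ≤ r → ∀ t, f (r • t) = r ^ β * f t) (hpos : ∀ t, t ≠ 0 → 0 < f t) :
    ∃ c : ℝ, 0 < c ∧ ∀ t, c * ‖t‖ ^ β ≤ f t := by
  have h0 : f 0 = 0 := by simpa [Real.zero_rpow hβ.ne'] using hom 0 le_rfl 0
  have hunit : ∀ t : E k, t ≠ 0 → ‖t‖⁻¹ • t ∈ Metric.sphere (0 : E k) 1 := by
    intro t ht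
    simp [norm_smul, ht]
  rcases (Metric.sphere (0 : E k) 1).eq_empty_or_nonempty with he | hne
  · refine ⟨1, one_pos, fun t => ?_⟩
    have ht : t = 0 := by
      by_contra ht
      exact Set.notMem_empty _ (he ▸ hunit t ht)
    simp [ht, h0, Real.zero_rpow hβ.ne']
  · obtain ⟨x, hx, hmin⟩ := (isCompact_sphere (0 : E k) 1).exists_isMinOn hne hf.continuousOn
    have hx0 : x ≠ 0 := by
      rintro rfl
      simp at hx
    refine ⟨f x, hpos x hx0, fun t => ?_⟩
    by_cases ht : t = 0
    · simp [ht, h0, Real.zero_rpow hβ.ne']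
    · have h1 : f x ≤ f (‖t‖⁻¹ • t) := hmin (hunit t ht)
      have h2 : f t = ‖t‖ ^ β * f (‖t‖⁻¹ • t) := by
        rw [← hom _ (norm_nonneg t), smul_smul, mul_inv_cancel₀ (norm_ne_zero_iff.2 ht), one_smul]
      rw [h2, mul_comm]
      exact mul_le_mul_of_nonneg_left h1 (by positivity)

lemma abs_inner_smul_rpow (α : ℝ) (a t : E k) {r : ℝ} (hr : 0 ≤ r) :
    |inner ℝ a (r • t)| ^ α = r ^ α * |inner ℝ a t| ^ α := by
  rw [real_inner_smul_right, abs_mul, abs_of_nonneg hr, Real.mul_rpow hr (abs_nonneg _)]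

/-- The inputs and the vector of ones span the space, so no `t ≠ 0` is orthogonal to all of them. -/
lemma exists_le_nodeExponent {I : ℕ} {α σw σb : ℝ} (hα : 0 < α) (hw : 0 < σw) (hb : 0 < σb)
    {X : Matrix (Fin I) (Fin k) ℝ}
    (hX : Submodule.span ℝ (insert (ones k) (Set.range (row X))) = ⊤) :
    ∃ c : ℝ, 0 < c ∧ ∀ t, c * ‖t‖ ^ α ≤ nodeExponent α σw σb (row X) t := by
  have hrp : ∀ x : E k, Continuous fun t : E k => |inner ℝ x t| ^ α := fun x =>
    (continuous_const.inner continuous_id).abs.rpow_const fun _ => Or.inr hα.le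
  refine exists_mul_rpow_norm_le hα ?_ ?_ ?_
  · unfold nodeExponent
    exact (continuous_const.mul (continuous_finsetSum _ fun j _ => hrp _)).add
      (continuous_const.mul (hrp _))
  · intro r hr t
    simp only [nodeExponent, abs_inner_smul_rpow α _ _ hr, ← Finset.mul_sum]
    ring
  · intro t ht
    have hwα := Real.rpow_pos_of_pos hw α
    have hbα := Real.rpow_pos_of_pos hb α
    by_contra! hle
    have h1 : 0 ≤ ∑ j, |inner ℝ (row X j) t| ^ α := Finset.sum_nonneg fun j _ => by positivity
    have h2 : 0 ≤ |inner ℝ (ones k) t| ^ α := by positivity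
    unfold nodeExponent at hle
    have h3 : ∑ j, |inner ℝ (row X j) t| ^ α = 0 := by nlinarith [mul_nonneg hbα.le h2]
    have h4 : |inner ℝ (ones k) t| ^ α = 0 := by nlinarith [mul_nonneg hwα.le h1]
    have h5 : ∀ x ∈ insert (ones k) (Set.range (row X)), inner ℝ x t = 0 := by
      have hz : ∀ x : E k, |inner ℝ x t| ^ α = 0 → inner ℝ x t = 0 := fun x hx =>
        abs_eq_zero.1 ((Real.rpow_eq_zero (abs_nonneg _) hα.ne').1 hx)
      rintro x (rfl | ⟨j, rfl⟩)
      · exact hz _ h4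
      · exact hz _ ((Finset.sum_eq_zero_iff_of_nonneg fun j _ => by positivity).1 h3 j
          (Finset.mem_univ j))
    have h6 : t ∈ Submodule.span ℝ (insert (ones k) (Set.range (row X))) := by
      rw [hX]; exact Submodule.mem_top
    have h7 : ∀ x ∈ Submodule.span ℝ (insert (ones k) (Set.range (row X))), inner ℝ x t = 0 := by
      intro x hx
      induction hx using Submodule.span_induction with
      | mem x hx => exact h5 x hx
      | zero => simp
      | add x y _ _ hx hy => rw [inner_add_left, hx, hy, add_zero]
      | smul a x _ hx => rw [real_inner_smul_left, hx, mul_zero]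
    exact ht (inner_self_eq_zero.1 (h7 t h6))

/-- The quadratic form of a matrix. -/
def quadForm (M : Fin k → Fin k → ℝ) (t : E k) : ℝ :=
  ∑ r, ∑ s, M r s * (t r * t s)

/-- The second moments of the activations of a random vector of law `q`. -/
def secondMoment (φ : ℝ → ℝ) (q : Measure (E k)) (r s : Fin k) : ℝ :=
  ∫ f, φ (f r) * φ (f s) ∂q

lemma sq_inner_eq_quadForm (a t : E k) :
    (inner ℝ a t : ℝ) ^ 2 = quadForm (fun r s => a r * a s) t := by
  rw [PiLp.inner_apply, sq, Finset.sum_mul_sum]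
  refine Finset.sum_congr rfl fun r _ => Finset.sum_congr rfl fun s _ => ?_
  simp only [RCLike.inner_apply, conj_trivial]
  ring

lemma mean_sq_inner_eq_quadForm (a : ℕ → E k) (n : ℕ) (t : E k) :
    (∑ j ∈ Finset.range n, (inner ℝ (a j) t : ℝ) ^ 2) / n =
      quadForm (fun r s => (∑ j ∈ Finset.range n, a j r * a j s) / n) t := by
  simp only [sq_inner_eq_quadForm, quadForm]
  rw [Finset.sum_comm, Finset.sum_div]
  refine Finset.sum_congr rfl fun r _ => ?_
  rw [Finset.sum_comm, Finset.sum_div]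
  refine Finset.sum_congr rfl fun s _ => ?_
  rw [← Finset.sum_mul]
  ring

lemma integral_sq_inner_eq_quadForm {φ : ℝ → ℝ} (hφ : Continuous φ)
    (hφb : ∃ M : ℝ, ∀ s, |φ s| ≤ M) (q : Measure (E k)) [IsFiniteMeasure q] (t : E k) :
    ∫ f, (inner ℝ (act φ f) t : ℝ) ^ 2 ∂q = quadForm (secondMoment φ q) t := by
  obtain ⟨M, hM⟩ := hφb
  have hint : ∀ r s : Fin k, Integrable (fun f : E k => φ (f r) * φ (f s)) q := by
    intro r s
    refine Integrable.of_bound (Continuous.aestronglyMeasurable (by fun_prop)) (M * M)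
      (ae_of_all _ fun f => ?_)
    rw [norm_mul]
    exact mul_le_mul (hM _) (hM _) (norm_nonneg _) ((abs_nonneg _).trans (hM 0))
  simp only [sq_inner_eq_quadForm, quadForm, secondMoment, act]
  rw [integral_finsetSum _ fun r _ => integrable_finsetSum _ fun s _ => (hint r s).mul_const _]
  refine Finset.sum_congr rfl fun r _ => ?_
  rw [integral_finsetSum _ fun s _ => (hint r s).mul_const _]
  exact Finset.sum_congr rfl fun s _ => integral_mul_const _ _

lemma quadForm_sub_le {M N : Fin k → Fin k → ℝ} {η : ℝ} (h : ∀ r s, |M r s - N r s| ≤ η) (t : E k) :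
    quadForm N t - (k : ℝ) ^ 2 * η * ‖t‖ ^ 2 ≤ quadForm M t := by
  have h1 : quadForm N t - quadForm M t ≤ ∑ _r : Fin k, ∑ _s : Fin k, η * ‖t‖ ^ 2 := by
    rw [quadForm, quadForm, ← Finset.sum_sub_distrib]
    refine Finset.sum_le_sum fun r _ => ?_
    rw [← Finset.sum_sub_distrib]
    refine Finset.sum_le_sum fun s _ => ?_
    calc N r s * (t r * t s) - M r s * (t r * t s) ≤ |(M r s - N r s) * (t r * t s)| := by
          rw [show N r s * (t r * t s) - M r s * (t r * t s) = -((M r s - N r s) * (t r * t s)) by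
            ring]
          exact neg_le_abs _
      _ = |M r s - N r s| * (‖t r‖ * ‖t s‖) := by
          rw [abs_mul, abs_mul, Real.norm_eq_abs, Real.norm_eq_abs]
      _ ≤ η * (‖t‖ * ‖t‖) := by
          have hη : 0 ≤ η := (abs_nonneg _).trans (h r s)
          have hr := PiLp.norm_apply_le t r
          have hs := PiLp.norm_apply_le t s
          gcongr
          exact h r s
      _ = _ := by ring
  simp only [Finset.sum_const, Finset.card_univ, Fintype.card_fin, nsmul_eq_mul] at h1
  linarith

/-- The activations of an absolutely continuous random vector do not lie on a hyperplane: since `φ`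
is injective, every line parallel to a suitable coordinate axis meets the preimage of the hyperplane
in at most one point. -/
lemma ae_inner_act_ne_zero {φ : ℝ → ℝ} (hφ : Continuous φ) (hinj : Function.Injective φ)
    {t : E k} (ht : t ≠ 0) : ∀ᵐ f : E k, inner ℝ (act φ f) t ≠ 0 := by
  obtain ⟨r, hr⟩ : ∃ r, t r ≠ 0 := by
    by_contra! h
    exact ht (PiLp.ext h)
  have hact := (continuous_act (k := k) hφ)
  have hs : MeasurableSet {f : E k | inner ℝ (act φ f) t ≠ 0} := by
    have : IsOpen {f : E k | inner ℝ (act φ f) t ≠ 0} :=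
      isOpen_ne_fun (hact.inner continuous_const) continuous_const
    exact this.measurableSet
  refine ae_mem_of_ae_add_linearMap_mem
    (LinearMap.toSpanSingleton ℝ (E k) (EuclideanSpace.single r (1 : ℝ))) volume volume hs fun y => ?_
  have hsub : {x : ℝ | ¬ y + LinearMap.toSpanSingleton ℝ (E k) (EuclideanSpace.single r (1 : ℝ)) x ∈
      {f : E k | inner ℝ (act φ f) t ≠ 0}}.Subsingleton := by
    intro x hx x' hx'
    simp only [Set.mem_ofPred_eq, not_not, LinearMap.toSpanSingleton_apply, PiLp.inner_apply,
      RCLike.inner_apply, conj_trivial, act] at hx hx'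
    rw [← Finset.add_sum_erase _ _ (Finset.mem_univ r)] at hx hx'
    have hrest : ∀ z : ℝ, ∑ i ∈ Finset.univ.erase r,
        t i * φ ((y + z • EuclideanSpace.single r (1 : ℝ)) i) =
        ∑ i ∈ Finset.univ.erase r, t i * φ (y i) := by
      intro z
      refine Finset.sum_congr rfl fun i hi => ?_
      simp [Finset.ne_of_mem_erase hi]
    rw [hrest] at hx hx'
    have h1 : φ ((y + x • EuclideanSpace.single r (1 : ℝ)) r) =
        φ ((y + x' • EuclideanSpace.single r (1 : ℝ)) r) :=
      mul_left_cancel₀ hr (by linarith)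
    simpa using hinj h1
  rw [ae_iff]
  exact hsub.measure_zero volume

lemma exists_le_quadForm_secondMoment {φ : ℝ → ℝ} (hφ : Continuous φ)
    (hinj : Function.Injective φ) (hφb : ∃ M : ℝ, ∀ s, |φ s| ≤ M) (q : Measure (E k))
    [IsProbabilityMeasure q] (hq : q ≪ volume) :
    ∃ c : ℝ, 0 < c ∧ ∀ t, c * ‖t‖ ^ (2 : ℝ) ≤ quadForm (secondMoment φ q) t := by
  refine exists_mul_rpow_norm_le two_pos ?_ ?_ ?_
  · unfold quadForm
    fun_prop
  · intro r _ t
    rw [quadForm, quadForm, Finset.mul_sum]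
    refine Finset.sum_congr rfl fun i _ => ?_
    rw [Finset.mul_sum]
    refine Finset.sum_congr rfl fun j _ => ?_
    rw [Real.rpow_two, PiLp.smul_apply, PiLp.smul_apply, smul_eq_mul, smul_eq_mul]
    ring
  · intro t ht
    rw [← integral_sq_inner_eq_quadForm hφ hφb]
    obtain ⟨R, hR, hbd⟩ := exists_norm_act_le hφb k
    have hint : Integrable (fun f : E k => (inner ℝ (act φ f) t : ℝ) ^ 2) q := by
      refine Integrable.of_bound (Continuous.aestronglyMeasurable
        (((continuous_act hφ).inner continuous_const).pow 2)) ((R * ‖t‖) ^ 2)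
        (ae_of_all _ fun f => ?_)
      rw [norm_pow]
      exact pow_le_pow_left₀ (norm_nonneg _) ((norm_inner_le_norm _ _).trans
        (mul_le_mul_of_nonneg_right (hbd f) (norm_nonneg t))) 2
    have hne := hq.ae_le (ae_inner_act_ne_zero hφ hinj ht)
    refine lt_of_le_of_ne (integral_nonneg fun f => sq_nonneg _) fun h0 => ?_
    have h1 := (integral_eq_zero_iff_of_nonneg (fun f => sq_nonneg _) hint).1 h0.symm
    obtain ⟨f, hf1, hf2⟩ := (h1.and hne).exists
    exact hf2 (pow_eq_zero_iff two_ne_zero |>.1 hf1)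

/-- For `α < 2` a bounded inner product has its square dominated by its power `α`; hence second
moments bound absolute moments of order `α` from below. -/
lemma sq_inner_le {α R : ℝ} (hα : 0 < α) (hα2 : α < 2) {a : E k} (ha : ‖a‖ ≤ R) (t : E k) :
    (inner ℝ a t : ℝ) ^ 2 ≤ (R * ‖t‖) ^ (2 - α) * |inner ℝ a t| ^ α := by
  have h1 : |inner ℝ a t| ≤ R * ‖t‖ :=
    (abs_real_inner_le_norm a t).trans (mul_le_mul_of_nonneg_right ha (norm_nonneg t))
  have h2 : (inner ℝ a t : ℝ) ^ 2 = |inner ℝ a t| ^ (2 - α) * |inner ℝ a t| ^ α := by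
    rw [← Real.rpow_add_of_nonneg (abs_nonneg _) (by linarith) hα.le, sub_add_cancel,
      Real.rpow_two, sq_abs]
  rw [h2]
  exact mul_le_mul_of_nonneg_right
    (Real.rpow_le_rpow (abs_nonneg _) h1 (by linarith)) (by positivity)

lemma mul_rpow_norm_le_of_le {α R c S : ℝ} (hα : 0 < α) (hR : 0 < R) (hS : 0 ≤ S)
    {t : E k} (h : c * ‖t‖ ^ 2 ≤ (R * ‖t‖) ^ (2 - α) * S) :
    c * R ^ (α - 2) * ‖t‖ ^ α ≤ S := by
  rcases (norm_nonneg t).eq_or_lt with h0 | hpos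
  · rw [← h0, Real.zero_rpow hα.ne', mul_zero]; exact hS
  · have h1 : (R * ‖t‖) ^ (α - 2) * (R * ‖t‖) ^ (2 - α) = 1 := by
      rw [← Real.rpow_add (by positivity)]; simp
    have h2 : ‖t‖ ^ (α - 2) * ‖t‖ ^ 2 = ‖t‖ ^ α := by
      rw [← Real.rpow_two, ← Real.rpow_add hpos]; simp
    calc c * R ^ (α - 2) * ‖t‖ ^ α = (R * ‖t‖) ^ (α - 2) * (c * ‖t‖ ^ 2) := by
          rw [← h2, Real.mul_rpow hR.le hpos.le]; ring
      _ ≤ (R * ‖t‖) ^ (α - 2) * ((R * ‖t‖) ^ (2 - α) * S) :=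
          mul_le_mul_of_nonneg_left h (by positivity)
      _ = S := by rw [← mul_assoc, h1, one_mul]

variable {Ω : Type*} [MeasurableSpace Ω] {P : Measure Ω} [IsProbabilityMeasure P]
  {α σw σb : ℝ} {φ : ℝ → ℝ}

/-- The limiting exponent and, with probability tending to one and almost surely for all large
widths, the empirical exponents are bounded below by the same multiple of `‖t‖ ^ α`. Only the
finitely many entries of the empirical second moment matrix have to converge. -/
theorem exists_le_exponents {Y : ℕ → Ω → E k} (hY : ∀ i, Measurable (Y i))
    (hind : iIndepFun Y P) (hlaw : ∀ i, P.map (Y i) = P.map (Y 0)) (hα : 0 < α) (hα2 : α < 2)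
    (hw : 0 < σw) (hb : 0 ≤ σb) (hφ : Continuous φ) (hinj : Function.Injective φ)
    (hφb : ∃ M : ℝ, ∀ s, |φ s| ≤ M) (hq : P.map (Y 0) ≪ volume) :
    ∃ c : ℝ, 0 < c ∧ (∀ t, c * ‖t‖ ^ α ≤ limitExponent α σw σb φ (P.map (Y 0)) t) ∧
      ∃ G : ℕ → Set Ω,
        (∀ n, ∀ ω ∈ G n, ∀ t,
          c * ‖t‖ ^ α ≤ empiricalExponent α σw σb (fun j => act φ (Y j ω)) n t) ∧
        (∀ᵐ ω ∂P, ∀ᶠ n in atTop, ω ∈ G n) ∧ Tendsto (fun n => P (G n)ᶜ) atTop (𝓝 0) := by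
  have hprob : IsProbabilityMeasure (P.map (Y 0)) :=
    Measure.isProbabilityMeasure_map (hY 0).aemeasurable
  obtain ⟨c, hc, hcle⟩ := exists_le_quadForm_secondMoment hφ hinj hφb (P.map (Y 0)) hq
  obtain ⟨R, hR, hbd⟩ := exists_norm_act_le hφb k
  have hwα : 0 < σw ^ α := Real.rpow_pos_of_pos hw α
  have hlow : ∀ t S : ℝ, 0 ≤ S → t ≤ S → ∀ x : E k,
      σw ^ α * t ≤ σw ^ α * S + σb ^ α * |inner ℝ (ones k) x| ^ α := by
    intro t S _ hS x
    have : 0 ≤ σb ^ α * |inner ℝ (ones k) x| ^ α := by positivity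
    nlinarith
  -- An error of at most `η` in each of the `k²` entries costs at most half of the constant `c`.
  let η : ℝ := c / 2 / ((k : ℝ) ^ 2 + 1)
  have hη : 0 < η := by positivity
  have hkη : (k : ℝ) ^ 2 * η ≤ c / 2 := by
    have : ((k : ℝ) ^ 2 + 1) * η = c / 2 := by simp only [η]; field_simp
    nlinarith
  let N : ℕ → Ω → Fin k → Fin k → ℝ := fun n ω r s =>
    (∑ j ∈ Finset.range n, φ (Y j ω r) * φ (Y j ω s)) / n
  refine ⟨σw ^ α * (c / 2 * R ^ (α - 2)), by positivity, fun t => ?_,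
    fun n => {ω | ∀ r s, |N n ω r s - secondMoment φ (P.map (Y 0)) r s| ≤ η}, ?_, ?_, ?_⟩
  · have hint : Integrable (fun f : E k => |inner ℝ (act φ f) t| ^ α) (P.map (Y 0)) := by
      refine Integrable.of_bound (measurable_abs_inner_act_rpow α hφ t).aestronglyMeasurable
        (R ^ α * ‖t‖ ^ α) (ae_of_all _ fun f => ?_)
      rw [Real.norm_of_nonneg (by positivity)]
      exact abs_inner_rpow_le hα.le (hbd f) t
    have hnn : 0 ≤ ∫ f, |inner ℝ (act φ f) t| ^ α ∂(P.map (Y 0)) :=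
      integral_nonneg fun f => by positivity
    rw [mul_assoc]
    refine hlow _ _ hnn (mul_rpow_norm_le_of_le hα hR hnn ?_) t
    have h1 := hcle t
    rw [← integral_sq_inner_eq_quadForm hφ hφb, Real.rpow_two] at h1
    calc c / 2 * ‖t‖ ^ 2 ≤ c * ‖t‖ ^ 2 := by nlinarith [sq_nonneg ‖t‖]
      _ ≤ _ := h1
      _ ≤ ∫ f, (R * ‖t‖) ^ (2 - α) * |inner ℝ (act φ f) t| ^ α ∂(P.map (Y 0)) :=
          integral_mono_of_nonneg (ae_of_all _ fun f => sq_nonneg _) (hint.const_mul _)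
            (ae_of_all _ fun f => sq_inner_le hα hα2 (hbd f) t)
      _ = _ := integral_const_mul _ _
  · intro n ω hω t
    have hnn : 0 ≤ (∑ j ∈ Finset.range n, |inner ℝ (act φ (Y j ω)) t| ^ α) / n := by positivity
    rw [mul_assoc]
    refine hlow _ _ hnn (mul_rpow_norm_le_of_le hα hR hnn ?_) t
    have h1 := hcle t
    rw [Real.rpow_two] at h1
    have h2 := quadForm_sub_le hω t
    calc c / 2 * ‖t‖ ^ 2 ≤ quadForm (N n ω) t := by nlinarith [sq_nonneg ‖t‖]
      _ = (∑ j ∈ Finset.range n, (inner ℝ (act φ (Y j ω)) t : ℝ) ^ 2) / n :=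
          (mean_sq_inner_eq_quadForm (fun j => act φ (Y j ω)) n t).symm
      _ ≤ (∑ j ∈ Finset.range n, (R * ‖t‖) ^ (2 - α) * |inner ℝ (act φ (Y j ω)) t| ^ α) / n := by
          gcongr with j _
          exact sq_inner_le hα hα2 (hbd _) t
      _ = _ := by rw [← Finset.mul_sum, mul_div_assoc]
  all_goals
    have hev : ∀ᵐ ω ∂P, ∀ᶠ n in atTop, ω ∈
        {ω | ∀ r s, |N n ω r s - secondMoment φ (P.map (Y 0)) r s| ≤ η} := by
      obtain ⟨M, hM⟩ := hφb
      have h1 : ∀ r s : Fin k, ∀ᵐ ω ∂P, Tendsto (fun n => N n ω r s) atTop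
          (𝓝 (secondMoment φ (P.map (Y 0)) r s)) := fun r s =>
        ae_tendsto_mean hY hind hlaw (g := fun f : E k => φ (f r) * φ (f s))
          (Continuous.measurable (by fun_prop)) (C := M * M) fun f => by
            rw [abs_mul]
            exact mul_le_mul (hM _) (hM _) (abs_nonneg _) ((abs_nonneg _).trans (hM 0))
      filter_upwards [ae_all_iff.2 fun r => ae_all_iff.2 (h1 r)] with ω hω
      refine eventually_all.2 fun r => eventually_all.2 fun s => ?_
      filter_upwards [Metric.tendsto_nhds.1 (hω r s) η hη] with n hn
      exact hn.le
  · exact hev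
  · rw [← measure_empty (μ := P)]
    refine tendsto_measure_of_ae_tendsto_indicator_of_isFiniteMeasure atTop MeasurableSet.empty
      (fun n => ?_) ?_
    · refine MeasurableSet.compl ?_
      simp only [Set.ofPred_forall]
      refine MeasurableSet.iInter fun r => MeasurableSet.iInter fun s => ?_
      have hN : Measurable fun ω => N n ω r s := by
        refine (Finset.measurable_sum _ fun j _ => ?_).div_const _
        have h1 : Measurable fun f : E k => φ (f r) * φ (f s) :=
          Continuous.measurable (by fun_prop)
        exact h1.comp (hY j)
      exact measurableSet_le (hN.sub_const _).abs measurable_const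
    · filter_upwards [hev] with ω hω
      filter_upwards [hω] with n hn
      exact ⟨fun h => h hn, fun h => h.elim⟩

end LowerBound

/-! ### The rate of convergence of the densities -/

section Rate

variable {k : ℕ}

lemma integrable_rpow_norm_mul_exp {α c s : ℝ} (hk : 1 ≤ k) (hα : 0 < α) (hc : 0 < c)
    (hs : 0 ≤ s) :
    Integrable (fun t : E k => ‖t‖ ^ s * Real.exp (-c * ‖t‖ ^ α)) := by
  have : Nonempty (Fin k) := ⟨⟨0, hk⟩⟩
  refine (integrable_fun_norm_addHaar (volume : Measure (E k))
    (f := fun y => y ^ s * Real.exp (-c * y ^ α))).2 ?_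
  have h := integrableOn_rpow_mul_exp_neg_mul_rpow (p := α) (b := c)
    (s := ((Module.finrank ℝ (E k) - 1 : ℕ) : ℝ) + s)
    (lt_of_lt_of_le (by norm_num) (by positivity : (0 : ℝ) ≤ _)) hα hc
  refine h.congr_fun (fun y hy => ?_) measurableSet_Ioi
  have hy' : (0 : ℝ) < y := hy
  simp only [smul_eq_mul]
  rw [Real.rpow_add hy', Real.rpow_natCast, mul_assoc]

lemma integrable_exp_norm {α c : ℝ} (hk : 1 ≤ k) (hα : 0 < α) (hc : 0 < c) :
    Integrable (fun t : E k => Real.exp (-c * ‖t‖ ^ α)) := by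
  simpa using integrable_rpow_norm_mul_exp hk hα hc le_rfl

/-- A finite measure has an integrable characteristic function if the exponent of that function is
at least a multiple of `‖t‖ ^ α`. -/
lemma integrable_charFun_of_le {α c : ℝ} (hk : 1 ≤ k) (hα : 0 < α) (hc : 0 < c)
    {μ : Measure (E k)} [IsFiniteMeasure μ] {A : E k → ℝ}
    (hμ : ∀ t, charFun μ t = ((Real.exp (-A t) : ℝ) : ℂ)) (hA : ∀ t, c * ‖t‖ ^ α ≤ A t) :
    Integrable (charFun μ) := by
  refine (integrable_exp_norm hk hα hc).mono' stronglyMeasurable_charFun.aestronglyMeasurable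
    (ae_of_all _ fun t => ?_)
  rw [hμ, Complex.norm_real, Real.norm_of_nonneg (Real.exp_pos _).le]
  exact Real.exp_le_exp.2 (by linarith [hA t])

lemma abs_exp_neg_sub_exp_neg_le {x y m : ℝ} (hx : m ≤ x) (hy : m ≤ y) :
    |Real.exp (-x) - Real.exp (-y)| ≤ Real.exp (-m) * |x - y| := by
  wlog hxy : x ≤ y generalizing x y
  · rw [abs_sub_comm, abs_sub_comm x y]
    exact this hy hx (le_of_not_ge hxy)
  have h1 : Real.exp (-y) ≤ Real.exp (-x) := Real.exp_le_exp.2 (by linarith)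
  rw [abs_of_nonneg (by linarith), abs_of_nonpos (by linarith)]
  have h2 : Real.exp (-y) = Real.exp (-x) * Real.exp (-(y - x)) := by
    rw [← Real.exp_add]; congr 1; ring
  have h3 : 1 - (y - x) ≤ Real.exp (-(y - x)) := by linarith [Real.add_one_le_exp (-(y - x))]
  have h4 : Real.exp (-x) ≤ Real.exp (-m) := Real.exp_le_exp.2 (by linarith)
  have h5 := (Real.exp_pos (-x)).le
  calc _ ≤ Real.exp (-x) * (y - x) := by rw [h2]; nlinarith
    _ ≤ Real.exp (-m) * (y - x) := mul_le_mul_of_nonneg_right h4 (by linarith)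
    _ = _ := by ring

variable {Ω : Type*} [MeasurableSpace Ω] {P : Measure Ω} [IsProbabilityMeasure P]
  {α σw σb : ℝ} {φ : ℝ → ℝ}

/-- The weighted `L¹` distance of the exponents, which bounds the uniform distance of the
densities. -/
def exponentDistance (α σw σb c : ℝ) (φ : ℝ → ℝ) (q : Measure (E k)) (f : ℕ → E k) (n : ℕ) :
    ℝ≥0∞ :=
  ∫⁻ t : E k, ENNReal.ofReal (Real.exp (-c * ‖t‖ ^ α) *
    |empiricalExponent α σw σb (fun j => act φ (f j)) n t - limitExponent α σw σb φ q t|)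

lemma ofReal_integral_charFun_sub_le {c : ℝ} (hk : 1 ≤ k) (hα : 0 < α) (hc : 0 < c)
    {q μ ν : Measure (E k)} [IsFiniteMeasure μ] [IsFiniteMeasure ν] {f : ℕ → E k} {n : ℕ}
    (hμ : ∀ t, charFun μ t =
      ((Real.exp (-empiricalExponent α σw σb (fun j => act φ (f j)) n t) : ℝ) : ℂ))
    (hν : ∀ t, charFun ν t = ((Real.exp (-limitExponent α σw σb φ q t) : ℝ) : ℂ))
    (hμc : ∀ t, c * ‖t‖ ^ α ≤ empiricalExponent α σw σb (fun j => act φ (f j)) n t)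
    (hνc : ∀ t, c * ‖t‖ ^ α ≤ limitExponent α σw σb φ q t) :
    ENNReal.ofReal (∫ t, ‖charFun μ t - charFun ν t‖) ≤
      exponentDistance α σw σb c φ q f n := by
  have h1 := (integrable_charFun_of_le hk hα hc hμ hμc).sub (integrable_charFun_of_le hk hα hc hν hνc)
  refine (ofReal_integral_norm_eq_lintegral_enorm h1).trans_le (lintegral_mono fun t => ?_)
  rw [← ofReal_norm]
  refine ENNReal.ofReal_le_ofReal ?_
  rw [Pi.sub_apply, hμ, hν, ← Complex.ofReal_sub, Complex.norm_real, Real.norm_eq_abs, neg_mul]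
  exact abs_exp_neg_sub_exp_neg_le (hμc t) (hνc t)

lemma measurable_limitExponent (hφ : Continuous φ) (q : Measure (E k)) [SFinite q] :
    Measurable (limitExponent α σw σb φ q) := by
  have h1 : Measurable fun p : E k × E k => |inner ℝ (act φ p.2) p.1| ^ α := by
    have := (continuous_act (k := k) hφ).measurable
    fun_prop
  have h2 : Measurable fun t : E k => ∫ f, |inner ℝ (act φ f) t| ^ α ∂q :=
    (h1.stronglyMeasurable.integral_prod_right').measurable
  unfold limitExponent
  fun_prop

lemma measurable_exponent_integrand {Y : ℕ → Ω → E k} (hY : ∀ i, Measurable (Y i))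
    (hφ : Continuous φ) (c : ℝ) (q : Measure (E k)) [SFinite q] (n : ℕ) :
    Measurable fun p : Ω × E k => ENNReal.ofReal (Real.exp (-c * ‖p.2‖ ^ α) *
      |empiricalExponent α σw σb (fun j => act φ (Y j p.1)) n p.2 -
        limitExponent α σw σb φ q p.2|) := by
  have h1 : ∀ j, Measurable fun p : Ω × E k => |inner ℝ (act φ (Y j p.1)) p.2| ^ α := by
    intro j
    have h2 : Measurable fun p : Ω × E k => act φ (Y j p.1) :=
      (continuous_act hφ).measurable.comp ((hY j).comp measurable_fst)
    fun_prop
  have h3 : Measurable fun p : Ω × E k =>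
      empiricalExponent α σw σb (fun j => act φ (Y j p.1)) n p.2 := by
    unfold empiricalExponent
    have := Finset.measurable_sum (Finset.range n) fun j _ => h1 j
    fun_prop
  have h4 : Measurable fun p : Ω × E k => limitExponent α σw σb φ q p.2 :=
    (measurable_limitExponent hφ q).comp measurable_snd
  fun_prop

/-- The expected weighted `L¹` distance of the exponents is `O(n^{-1/2})`: integrate the bound on the
mean absolute deviation over `t`, by Tonelli. -/
lemma exists_lintegral_exponentDistance_le {c : ℝ} (hk : 1 ≤ k) {Y : ℕ → Ω → E k}
    (hY : ∀ i, Measurable (Y i)) (hind : iIndepFun Y P)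
    (hlaw : ∀ i, P.map (Y i) = P.map (Y 0)) (hα : 0 < α) (hw : 0 ≤ σw) (hφ : Continuous φ)
    (hφb : ∃ M : ℝ, ∀ s, |φ s| ≤ M) (hc : 0 < c) :
    ∃ K : ℝ, 0 ≤ K ∧ ∀ n : ℕ, 0 < n →
      ∫⁻ ω, exponentDistance α σw σb c φ (P.map (Y 0)) (fun j => Y j ω) n ∂P ≤
        ENNReal.ofReal (K * (n : ℝ) ^ (-(1 / 2) : ℝ)) := by
  obtain ⟨R, hR, hbd⟩ := exists_norm_act_le hφb k
  have hint := (integrable_rpow_norm_mul_exp hk hα hc hα.le).const_mul (σw ^ α * R ^ α)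
  refine ⟨∫ t : E k, σw ^ α * R ^ α * (‖t‖ ^ α * Real.exp (-c * ‖t‖ ^ α)),
    integral_nonneg fun t => by positivity, fun n hn => ?_⟩
  simp only [exponentDistance]
  rw [lintegral_lintegral_swap (measurable_exponent_integrand hY hφ c _ n).aemeasurable,
    ← integral_mul_const, ofReal_integral_eq_lintegral_ofReal (hint.mul_const _)
      (ae_of_all _ fun t => by positivity)]
  refine lintegral_mono fun t => ?_
  have hg := measurable_abs_inner_act_rpow (k := k) α hφ t
  have hgb : ∀ f : E k, |(|inner ℝ (act φ f) t| ^ α)| ≤ R ^ α * ‖t‖ ^ α := fun f => by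
    rw [abs_of_nonneg (by positivity)]
    exact abs_inner_rpow_le hα.le (hbd f) t
  set m : ℝ := ∫ f, |inner ℝ (act φ f) t| ^ α ∂(P.map (Y 0)) with hm
  set S : Ω → ℝ := fun ω => (∑ j ∈ Finset.range n, |inner ℝ (act φ (Y j ω)) t| ^ α) / n with hS
  have hdiff : ∀ ω, |empiricalExponent α σw σb (fun j => act φ (Y j ω)) n t -
      limitExponent α σw σb φ (P.map (Y 0)) t| = σw ^ α * |S ω - m| := by
    intro ω
    rw [empiricalExponent, limitExponent, add_sub_add_right_eq_sub, ← mul_sub, abs_mul,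
      abs_of_nonneg (by positivity)]
  have hSm : Measurable S := (Finset.measurable_sum _ fun j _ => hg.comp (hY j)).div_const _
  have hSb : ∀ ω, |S ω| ≤ R ^ α * ‖t‖ ^ α := by
    intro ω
    rw [hS, abs_div, abs_of_pos (by positivity : (0 : ℝ) < n), div_le_iff₀ (by positivity)]
    refine (Finset.abs_sum_le_sum_abs _ _).trans ((Finset.sum_le_sum fun j _ => hgb _).trans ?_)
    simp [mul_comm]
  have hSint : Integrable (fun ω => |S ω - m|) P :=
    ((Integrable.of_bound hSm.aestronglyMeasurable _ (ae_of_all _ hSb)).sub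
      (integrable_const m)).abs
  simp only [hdiff]
  rw [← ofReal_integral_eq_lintegral_ofReal ((hSint.const_mul _).const_mul _)
    (ae_of_all _ fun ω => by positivity), integral_const_mul, integral_const_mul]
  refine ENNReal.ofReal_le_ofReal ?_
  calc _ ≤ Real.exp (-c * ‖t‖ ^ α) * (σw ^ α * (R ^ α * ‖t‖ ^ α * (n : ℝ) ^ (-(1 / 2) : ℝ))) := by
        have := integral_abs_mean_sub_le hY hind hlaw hg hgb hn
        gcongr
    _ = _ := by ring

/-- Let the random measures `μ n` have the characteristic functions of nodes of width `n` with
frozen i.i.d. inputs of absolutely continuous law. They are almost surely absolutely continuous for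
all large `n`, and their densities converge uniformly in probability, at every rate
`n^{-1/2 + ε}`. -/
theorem ae_absolutelyContinuous_and_tendsto_densities (hk : 1 ≤ k) {Y : ℕ → Ω → E k}
    (hY : ∀ i, Measurable (Y i)) (hind : iIndepFun Y P)
    (hlaw : ∀ i, P.map (Y i) = P.map (Y 0)) (hα : 0 < α) (hα2 : α < 2)
    (hw : 0 < σw) (hb : 0 ≤ σb) (hφ : Continuous φ) (hinj : Function.Injective φ)
    (hφb : ∃ M : ℝ, ∀ s, |φ s| ≤ M) (hq : P.map (Y 0) ≪ volume)
    {μ : ℕ → Ω → Measure (E k)} [∀ n ω, IsFiniteMeasure (μ n ω)]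
    (hμ : ∀ᵐ ω ∂P, ∀ n t, charFun (μ n ω) t =
      ((Real.exp (-empiricalExponent α σw σb (fun j => act φ (Y j ω)) n t) : ℝ) : ℂ))
    {ν : Measure (E k)} [IsFiniteMeasure ν]
    (hν : ∀ t, charFun ν t = ((Real.exp (-limitExponent α σw σb φ (P.map (Y 0)) t) : ℝ) : ℂ)) :
    (∀ᵐ ω ∂P, ∀ᶠ n : ℕ in atTop, μ n ω ≪ volume) ∧
      ∀ (gn : ℕ → Ω → E k → ℝ) (g : E k → ℝ),
        (∀ᵐ ω ∂P, ∀ n, μ n ω ≪ volume → IsDensity (μ n ω) (gn n ω)) → IsDensity ν g →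
        ∀ ε : ℝ, 0 < ε → ∀ δ : ℝ, 0 < δ →
          Tendsto (fun n : ℕ => P {ω | ENNReal.ofReal δ ≤
            ENNReal.ofReal ((n : ℝ) ^ (1 / 2 - ε)) *
              eLpNorm (fun x => gn n ω x - g x) ∞ volume}) atTop (𝓝 0) := by
  obtain ⟨c, hc, hlim, G, hG, hGev, hGP⟩ := exists_le_exponents hY hind hlaw hα hα2 hw hb hφ hinj
    hφb hq
  have hνint := integrable_charFun_of_le hk hα hc hν hlim
  refine ⟨?_, ?_⟩
  · filter_upwards [hμ, hGev] with ω hω hev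
    filter_upwards [hev] with n hn
    exact absolutelyContinuous_of_integrable_charFun
      (integrable_charFun_of_le hk hα hc (hω n) (hG n ω hn))
  intro gn g hgn hg ε hε δ hδ
  obtain ⟨K, hK, hKle⟩ := exists_lintegral_exponentDistance_le (σb := σb) hk hY hind hlaw hα hw.le hφ
    hφb hc
  have hqprob : IsProbabilityMeasure (P.map (Y 0)) :=
    Measure.isProbabilityMeasure_map (hY 0).aemeasurable
  set U : ℕ → Ω → ℝ≥0∞ := fun n ω =>
    exponentDistance α σw σb c φ (P.map (Y 0)) (fun j => Y j ω) n with hU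
  have hUm : ∀ n, Measurable (U n) := fun n =>
    (measurable_exponent_integrand hY hφ c (P.map (Y 0)) n).lintegral_prod_right'
  have hδ' : ENNReal.ofReal δ ≠ 0 := by simpa using hδ
  have hbound : ∀ n : ℕ, 0 < n → P {ω | ENNReal.ofReal δ ≤
      ENNReal.ofReal ((n : ℝ) ^ (1 / 2 - ε)) * eLpNorm (fun x => gn n ω x - g x) ∞ volume} ≤
      P (G n)ᶜ + ENNReal.ofReal (K * (n : ℝ) ^ (-ε)) / ENNReal.ofReal δ := by
    intro n hn
    have hn' : (0 : ℝ) < n := by exact_mod_cast hn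
    calc _ ≤ P ((G n)ᶜ ∪ {ω | ENNReal.ofReal δ ≤
          ENNReal.ofReal ((n : ℝ) ^ (1 / 2 - ε)) * U n ω}) := by
          refine measure_mono_ae ?_
          filter_upwards [hμ, hgn] with ω hω hgω hmem
          by_cases hωG : ω ∈ G n
          · refine Or.inr (le_trans hmem ?_)
            have hint := integrable_charFun_of_le hk hα hc (hω n) (hG n ω hωG)
            have hden := hgω n (absolutelyContinuous_of_integrable_charFun hint)
            gcongr
            exact (eLpNorm_density_sub_le hden hg hint hνint).trans
              (ofReal_integral_charFun_sub_le hk hα hc (hω n) hν (hG n ω hωG) hlim)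
          · exact Or.inl hωG
      _ ≤ P (G n)ᶜ + P {ω | ENNReal.ofReal δ ≤
          ENNReal.ofReal ((n : ℝ) ^ (1 / 2 - ε)) * U n ω} := measure_union_le _ _
      _ ≤ _ := by
          gcongr
          refine (meas_ge_le_lintegral_div ((hUm n).const_mul _).aemeasurable hδ'
            ENNReal.ofReal_ne_top).trans ?_
          gcongr
          rw [lintegral_const_mul _ (hUm n)]
          calc _ ≤ ENNReal.ofReal ((n : ℝ) ^ (1 / 2 - ε)) *
                ENNReal.ofReal (K * (n : ℝ) ^ (-(1 / 2) : ℝ)) := by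
                gcongr
                exact hKle n hn
            _ = _ := by
                rw [← ENNReal.ofReal_mul (by positivity)]
                congr 1
                rw [mul_left_comm, ← Real.rpow_add hn']
                congr 2
                ring
  have hlim0 : Tendsto (fun n : ℕ => P (G n)ᶜ +
      ENNReal.ofReal (K * (n : ℝ) ^ (-ε)) / ENNReal.ofReal δ) atTop (𝓝 0) := by
    have h1 : Tendsto (fun n : ℕ => K * (n : ℝ) ^ (-ε)) atTop (𝓝 0) := by
      simpa using ((tendsto_rpow_neg_atTop hε).comp tendsto_natCast_atTop_atTop).const_mul K
    have h2 := ENNReal.Tendsto.div_const (ENNReal.tendsto_ofReal h1)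
      (b := ENNReal.ofReal δ) (Or.inr hδ')
    simpa using hGP.add h2
  refine tendsto_of_tendsto_of_tendsto_of_le_of_le' tendsto_const_nhds hlim0
    (Eventually.of_forall fun _ => zero_le) ?_
  filter_upwards [eventually_gt_atTop 0] with n hn
  exact hbound n hn

end Rate

/-! ### The layers of the network -/

section Layers

variable {Ω : Type*} [MeasurableSpace Ω] {P : Measure Ω} [IsProbabilityMeasure P]
  {α σw σb : ℝ} {φ : ℝ → ℝ} {I k D : ℕ} {X : Matrix (Fin I) (Fin k) ℝ}
  {w₁ : ℕ → Fin I → Ω → ℝ} {w : ℕ → ℕ → ℕ → Ω → ℝ} {b : ℕ → ℕ → Ω → ℝ} {F : ℕ → ℕ → Ω → E k}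

/-- The trivial sigma-algebra carries no information: the conditional law of `Y` given `𝒢_0` is the
law of `Y`. -/
lemma condLaw_past_zero_ae_eq {Y : Ω → E k} (hY : Measurable Y) :
    ∀ᵐ ω ∂P, condLaw P (past F 0) Y ω = P.map Y := by
  have hbot : past F 0 = ⊥ := by
    simp [past]
  have hind : @IndepFun Ω Ω _ _ (past F 0) _ id Y P := by
    refine (@IndepFun_iff_Indep Ω Ω _ _ (past F 0) _ id Y P).2 ?_
    rw [MeasurableSpace.comap_id, hbot]
    exact indep_bot_left _
  have hid : @Measurable Ω Ω _ (past F 0) id := measurable_id'' (hbot ▸ bot_le)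
  have hH : @Measurable _ _ (@Prod.instMeasurableSpace _ _ (past F 0) _) _
      (Function.uncurry fun (_ : Ω) (y : E k) => y) := @measurable_snd _ _ (past F 0) _
  exact @condDistrib_of_indepFun_freeze Ω Ω (E k) (E k) _ (past F 0) _ P _ id Y _ _ _ hid hY hind
    (fun _ y => y) hH

namespace IsSequentialNN

lemma map_limit_eq (h : IsSequentialNN P α σw σb φ X D w₁ w b F) (hα : 0 < α) (hw : 0 ≤ σw)
    (hb : 0 ≤ σb) (hφ : Continuous φ) (hφb : ∃ M : ℝ, ∀ s, |φ s| ≤ M) {l : ℕ}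
    (hl : l + 1 ∈ Set.Icc 1 D) (i j : ℕ) : P.map (F (l + 1) i) = P.map (F (l + 1) j) := by
  have hchar := (h.iIndepFun_limit hα hw hb hφ hφb l hl).2
  have := Measure.isProbabilityMeasure_map (μ := P) (h.measurable_limit _ hl i).aemeasurable
  have := Measure.isProbabilityMeasure_map (μ := P) (h.measurable_limit _ hl j).aemeasurable
  exact Measure.ext_of_charFun (funext fun t => by rw [hchar, hchar])

lemma map_limit_one_absolutelyContinuous (h : IsSequentialNN P α σw σb φ X D w₁ w b F)
    (hα : 0 < α) (hw : 0 < σw) (hb : 0 < σb) (hφ : Continuous φ)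
    (hφb : ∃ M : ℝ, ∀ s, |φ s| ≤ M) (hk : 1 ≤ k)
    (hX : Submodule.span ℝ (insert (ones k) (Set.range (row X))) = ⊤) (hD : 1 ≤ D) (i : ℕ) :
    P.map (F 1 i) ≪ volume := by
  have hl : 0 + 1 ∈ Set.Icc 1 D := ⟨le_rfl, hD⟩
  obtain ⟨c, hc, hle⟩ := exists_le_nodeExponent hα hw hb hX
  exact absolutelyContinuous_of_integrable_charFun (integrable_charFun_of_le hk hα hc
    ((h.iIndepFun_limit hα hw.le hb.le hφ hφb 0 hl).2 i) hle)

/-- The null sets of the conditional laws for the countably many widths are discarded at once. -/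
lemma ae_charFun_condLaw_layer (h : IsSequentialNN P α σw σb φ X D w₁ w b F) (hα : 0 < α)
    (hφ : Continuous φ) {l : ℕ} (hl : l + 2 ∈ Set.Icc 2 D) (i : ℕ) :
    ∀ᵐ ω ∂P, ∀ n t, charFun (condLaw P (past F (l + 1)) (layer α φ X w₁ w b F (l + 2) n i) ω) t =
      ((Real.exp (-empiricalExponent α σw σb (fun j => act φ (F (l + 1) j ω)) n t) : ℝ) : ℂ) := by
  filter_upwards [ae_all_iff.2 fun n => h.condLaw_layer_ae_eq hφ hl n i] with ω hω n t
  rw [hω n]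
  exact h.charFun_frozen_node hα hφ hl n i _ t

/-- By induction on the layer, since the lower bound for the exponent of a layer needs a density of
the previous one. -/
lemma map_limit_absolutelyContinuous (h : IsSequentialNN P α σw σb φ X D w₁ w b F)
    (hα : 0 < α) (hα2 : α < 2) (hw : 0 < σw) (hb : 0 < σb) (hφ : Continuous φ)
    (hinj : Function.Injective φ) (hφb : ∃ M : ℝ, ∀ s, |φ s| ≤ M) (hk : 1 ≤ k)
    (hX : Submodule.span ℝ (insert (ones k) (Set.range (row X))) = ⊤) (l : ℕ)
    (hl : l + 1 ∈ Set.Icc 1 D) (i : ℕ) : P.map (F (l + 1) i) ≪ volume := by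
  induction l generalizing i with
  | zero => exact h.map_limit_one_absolutelyContinuous hα hw hb hφ hφb hk hX hl.2 i
  | succ l ih =>
    have hl' : l + 1 ∈ Set.Icc 1 D := ⟨by omega, by have := hl.2; omega⟩
    obtain ⟨c, hc, hlim, -⟩ := exists_le_exponents (σb := σb) (h.measurable_limit _ hl')
      (h.iIndepFun_limit hα hw.le hb.le hφ hφb l hl').1
      (fun i => h.map_limit_eq hα hw.le hb.le hφ hφb hl' i 0) hα hα2 hw hb.le hφ hinj hφb (ih hl' 0)
    exact absolutelyContinuous_of_integrable_charFun (integrable_charFun_of_le hk hα hc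
      ((h.iIndepFun_limit hα hw.le hb.le hφ hφb (l + 1) hl).2 i) hlim)

end IsSequentialNN

end Layers

end StableNN

end

theorem theorem4 {Ω : Type*} [MeasurableSpace Ω] (P : Measure Ω) [IsProbabilityMeasure P]
    (α σw σb : ℝ) (hα0 : 0 < α) (hα2 : α < 2) (hσw : 0 < σw) (hσb : 0 < σb)
    (φ : ℝ → ℝ) (hφ_cont : Continuous φ) (hφ_mono : StrictMono φ ∨ StrictAnti φ)
    (hφ_bdd : ∃ M : ℝ, ∀ s, |φ s| ≤ M)
    (I k D : ℕ) (hI : 1 ≤ I) (hk : 1 ≤ k) (hD : 1 ≤ D)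
    (X : Matrix (Fin I) (Fin k) ℝ)
    (hX : Submodule.span ℝ (insert (StableNN.ones k) (Set.range (StableNN.row X))) = ⊤)
    (w₁ : ℕ → Fin I → Ω → ℝ) (w : ℕ → ℕ → ℕ → Ω → ℝ) (b : ℕ → ℕ → Ω → ℝ)
    (F : ℕ → ℕ → Ω → StableNN.E k)
    (hNN : StableNN.IsSequentialNN P α σw σb φ X D w₁ w b F)
    (l : ℕ) (hl : l ∈ Set.Icc 1 D) :
    -- the limit of layer `l` is i.i.d. Stable with the recursive spectral measure
    (iIndepFun (F l) P ∧
      ∀ i, StableNN.IsStableVec α (StableNN.spectral P α σw σb φ X F l) (P.map (F l i))) ∧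
    -- the limiting law has a density
    (∀ i, P.map (F l i) ≪ volume) ∧
    -- almost surely the conditional law has a density for all large widths
    (∀ i, ∀ᵐ ω ∂P, ∀ᶠ n : ℕ in atTop,
      StableNN.condLaw P (StableNN.past F (l - 1))
        (StableNN.layer α φ X w₁ w b F l n i) ω ≪ volume) ∧
    -- the rate, for all versions of the densities, extended arbitrarily where there is none
    (∀ (i j : ℕ) (gn : ℕ → Ω → StableNN.E k → ℝ) (g : StableNN.E k → ℝ),
      (∀ᵐ ω ∂P, ∀ n : ℕ,
        StableNN.condLaw P (StableNN.past F (l - 1))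
          (StableNN.layer α φ X w₁ w b F l n i) ω ≪ volume →
        StableNN.IsDensity (StableNN.condLaw P (StableNN.past F (l - 1))
          (StableNN.layer α φ X w₁ w b F l n i) ω) (gn n ω)) →
      StableNN.IsDensity (P.map (F l j)) g →
      ∀ ε : ℝ, 0 < ε → ∀ δ : ℝ, 0 < δ →
        Tendsto (fun n : ℕ => P {ω | ENNReal.ofReal δ ≤
          ENNReal.ofReal ((n : ℝ) ^ (1 / 2 - ε)) *
            eLpNorm (fun x => gn n ω x - g x) ∞ volume}) atTop (𝓝 0)) := by
  obtain ⟨l, rfl⟩ : ∃ l', l = l' + 1 := ⟨l - 1, by have := hl.1; omega⟩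
  rw [Nat.add_sub_cancel]
  have hinj : Function.Injective φ := hφ_mono.elim StrictMono.injective StrictAnti.injective
  obtain ⟨hind, hchar⟩ := hNN.iIndepFun_limit hα0 hσw.le hσb.le hφ_cont hφ_bdd l hl
  have hmeas := hNN.measurable_limit _ hl
  have hprob : ∀ i, IsProbabilityMeasure (P.map (F (l + 1) i)) := fun i =>
    Measure.isProbabilityMeasure_map (hmeas i).aemeasurable
  have hac := hNN.map_limit_absolutelyContinuous hα0 hα2 hσw hσb hφ_cont hinj hφ_bdd hk hX l hl
  refine ⟨⟨hind, fun i => StableNN.isStableVec_spectral hα0 hσw.le hσb.le hφ_cont hφ_bdd (hchar i)⟩,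
    hac, ?_⟩
  rcases l with _ | l
  · -- The first layer does not depend on the width and its conditional law is its law.
    have hlayer : ∀ n i, StableNN.layer α φ X w₁ w b F (0 + 1) n i = F (0 + 1) i := fun n i => by
      rw [Nat.zero_add, hNN.limit_one]; rfl
    simp only [hlayer]
    have hcond := fun i => StableNN.condLaw_past_zero_ae_eq (P := P) (F := F) (hmeas i)
    refine ⟨fun i => ?_, fun i j gn g hgn hg ε _ δ hδ => ?_⟩
    · filter_upwards [hcond i] with ω hω
      exact Eventually.of_forall fun _ => hω ▸ hac i
    · have hij := hNN.map_limit_eq hα0 hσw.le hσb.le hφ_cont hφ_bdd hl i j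
      refine tendsto_const_nhds.congr fun n => ?_
      symm
      refine measure_eq_zero_iff_ae_notMem.2 ?_
      filter_upwards [hcond i, hgn] with ω hω hgω hmem
      have h1 := hgω n (hω ▸ hac i)
      rw [hω, hij] at h1
      have h2 : gn n ω =ᵐ[volume] g := h1.ae_eq hg
      have h3 : eLpNorm (fun x => gn n ω x - g x) ∞ volume = 0 := by
        rw [eLpNorm_congr_ae (g := fun _ => (0 : ℝ)) (by filter_upwards [h2] with x hx; simp [hx])]
        exact eLpNorm_zero'
      have h4 : ENNReal.ofReal δ ≤ _ := hmem
      rw [h3, mul_zero, nonpos_iff_eq_zero, ENNReal.ofReal_eq_zero] at h4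
      exact absurd hδ h4.not_gt
  · have hl' : l + 1 ∈ Set.Icc 1 D := ⟨by omega, by have := hl.2; omega⟩
    have hl2 : l + 2 ∈ Set.Icc 2 D := ⟨by omega, hl.2⟩
    have hfin : ∀ i n ω, IsFiniteMeasure (StableNN.condLaw P (StableNN.past F (l + 1))
        (StableNN.layer α φ X w₁ w b F (l + 2) n i) ω) := fun i n ω => by
      unfold StableNN.condLaw; infer_instance
    have key := fun i j => StableNN.ae_absolutelyContinuous_and_tendsto_densities hk
      (hNN.measurable_limit _ hl') (hNN.iIndepFun_limit hα0 hσw.le hσb.le hφ_cont hφ_bdd l hl').1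
      (fun i => hNN.map_limit_eq hα0 hσw.le hσb.le hφ_cont hφ_bdd hl' i 0) hα0 hα2 hσw hσb.le hφ_cont
      hinj hφ_bdd
      (hNN.map_limit_absolutelyContinuous hα0 hα2 hσw hσb hφ_cont hinj hφ_bdd hk hX l hl' 0)
      (hNN.ae_charFun_condLaw_layer hα0 hφ_cont hl2 i) (hchar j)
    exact ⟨fun i => (key i 0).1, fun i j => (key i j).2⟩
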